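/- Let $M\ge 1$ and let $\mathcal H_M=(L^2(\mathbb R)\otimes\mathbb C^2)^{\otimes M}\cong L^2(\mathbb R^M;(\mathbb C^2)^{\otimes M})$. Let $|m\rangle$, $m\in\mathbb N_0$, be the normalized Hermite functions in $L^2(\mathbb R)$, let $|0\rangle,|1\rangle$ be the standard basis of $\mathbb C^2$ (ground and excited state), and let $$D=\operatorname{span}\{|m_1\rangle\otimes|b_1\rangle\otimes\cdots\otimes|m_M\rangle\otimes|b_M\rangle : m_k\in\mathbb N_0,\ b_k\in\{0,1\}\}.$$ Let $a_k=(x_k+\partial_{x_k})/\sqrt2$ and $a_k^*=(x_k-\partial_{x_k})/\sqrt2$ be the annihilation and creation operators of the $k$-th oscillator, let $\sigma^x_k,\sigma^y_k,\sigma^z_k$ be the Pauli matrices acting on the $k$-th factor $\mathbb C^2$ (with $\sigma^z|1\rangle=|1\rangle$, $\sigma^z|0\rangle=-|0\rangle$), and let $\sigma_k^\pm=(\sigma_k^x\pm i\sigma_k^y)/2$, where $\sigma^+|0\rangle=|1\rangle$. For positive real constants $\omega^P_k,\omega^A_k,\omega^I_k$ $(k=1,\dots,M)$ put, on $D$, $$H_P=\sum_{k=1}^M\omega^P_k\,a_k^*a_k,\qquad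 H_A=\sum_{k=1}^M\omega^A_k\,\sigma^z_k,\qquad H_I=\sum_{k=1}^M\omega^I_k\,(a_k^*\sigma_k^-+a_k\sigma_k^+),\qquad H_0=H_P+H_I+H_A .$$ Then for every $i\in\{1,\dots,M\}$ the operator $H_0+\sigma^x_i$ is essentially self-adjoint on $D$, and its self-adjoint closure $T$ has compact resolvent: there is a real $\lambda$ for which $\lambda-T:\operatorname{dom}(T)\to\mathcal H_M$ is a bijection with bounded inverse, and $(z-T)^{-1}$ is a compact operator for every $z\in\mathbb C$ in the resolvent set of $T$. -/

import Mathlib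

open scoped SchwartzMap ContDiff Nat

noncomputable section

namespace JCH

/-- Configuration space `ℝ^M` of the `M` oscillator modes. -/
abbrev Config (M : ℕ) : Type := EuclideanSpace ℝ (Fin M)

/-- The Hilbert space `(ℂ²)^{⊗ M}` of the `M` atoms, with its orthonormal basis `|b₁ … b_M⟩`,
`b : Fin M → Fin 2` (`0` is the ground state, `1` the excited state of an atom). -/
abbrev Atoms (M : ℕ) : Type := EuclideanSpace ℂ (Fin M → Fin 2)

/-- The Hilbert space `(L²(ℝ) ⊗ ℂ²)^{⊗ M} = L²(ℝ^M; (ℂ²)^{⊗ M})` of `M` cavities. -/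
abbrev HilbertSpace (M : ℕ) : Type :=
  MeasureTheory.Lp (Atoms M) 2 (MeasureTheory.volume : MeasureTheory.Measure (Config M))

/-! ### Hermite functions and the finite excitation subspace -/

/-- The `n`-th `L²(ℝ)`-normalised Hermite function
`h_n(t) = (n! √π)^{-1/2} He_n(√2 t) e^{-t²/2} = (2ⁿ n! √π)^{-1/2} H_n(t) e^{-t²/2}`;
`Polynomial.hermite n` is the probabilists' Hermite polynomial `He_n`. -/
def hermiteFn (n : ℕ) (t : ℝ) : ℝ :=
  (Real.sqrt ((n ! : ℝ) * Real.sqrt Real.pi))⁻¹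
    * Polynomial.aeval (Real.sqrt 2 * t) (Polynomial.hermite n) * Real.exp (-(t ^ 2 / 2))

/-- The Gaussian `exp (-‖x‖² / 2)` as a Schwartz function on `ℝ^M`. -/
def gaussian (M : ℕ) : 𝓢(Config M, ℝ) where
  toFun x := Real.exp (-(‖x‖ ^ 2 / 2))
  smooth' := by
    have h : ContDiff ℝ ∞ fun x : Config M => ‖x‖ ^ 2 := contDiff_norm_sq ℝ
    fun_prop
  decay' := by
    intro k n
    have hsq : (fun x : Config M => -(‖x‖ ^ 2 / 2)).HasTemperateGrowth := by
      have h := (Function.hasTemperateGrowth_norm_sq (H := Config M)).mul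
        (Function.HasTemperateGrowth.const (E := Config M) (-(1 / 2) : ℝ))
      have e : (fun x : Config M => -(‖x‖ ^ 2 / 2))
          = (fun x : Config M => ‖x‖ ^ 2) * fun _ => (-(1 / 2) : ℝ) := by
        funext x
        simp only [Pi.mul_apply]
        ring
      rw [e]
      exact h
    obtain ⟨l, C, hC, hb⟩ := hsq.norm_iteratedFDeriv_le_uniform n
    set A : ℝ := 1 + C with hA
    have hA1 : 1 ≤ A := by linarith
    -- a bound on `(1 + r)^p * exp (-r²/2)`
    obtain ⟨K, hK⟩ : ∃ K : ℝ, ∀ r : ℝ, 0 ≤ r →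
        (1 + r) ^ (k + l * n) * Real.exp (-(r ^ 2 / 2)) ≤ K := by
      refine ⟨((k + l * n)! : ℝ) * Real.exp 2, fun r hr => ?_⟩
      have h1 : (1 + r) ^ (k + l * n) ≤ ((k + l * n)! : ℝ) * Real.exp (1 + r) := by
        have h := Real.pow_div_factorial_le_exp (1 + r) (by linarith) (k + l * n)
        rw [div_le_iff₀ (by positivity)] at h
        linarith
      have h2 : Real.exp (1 + r) * Real.exp (-(r ^ 2 / 2)) ≤ Real.exp 2 := by
        rw [← Real.exp_add]
        apply Real.exp_le_exp.mpr
        nlinarith [sq_nonneg (r - 1)]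
      calc (1 + r) ^ (k + l * n) * Real.exp (-(r ^ 2 / 2))
          ≤ (((k + l * n)! : ℝ) * Real.exp (1 + r)) * Real.exp (-(r ^ 2 / 2)) := by gcongr
        _ = ((k + l * n)! : ℝ) * (Real.exp (1 + r) * Real.exp (-(r ^ 2 / 2))) := by ring
        _ ≤ _ := by gcongr
    refine ⟨(n ! : ℝ) * A ^ n * K, fun x => ?_⟩
    have hcomp := norm_iteratedFDeriv_comp_le (𝕜 := ℝ) (n := n) (N := ∞) (g := Real.exp)
      (f := fun x : Config M => -(‖x‖ ^ 2 / 2)) Real.contDiff_exp hsq.1 (by exact_mod_cast le_top) x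
      (C := Real.exp (-(‖x‖ ^ 2 / 2))) (D := A * (1 + ‖x‖) ^ l)
      (by
        intro j _
        rw [norm_iteratedFDeriv_eq_norm_iteratedDeriv, iteratedDeriv_eq_iterate, Real.iter_deriv_exp]
        simp)
      (by
        intro j hj hjn
        have h1 : (1 : ℝ) ≤ A * (1 + ‖x‖) ^ l :=
          one_le_mul_of_one_le_of_one_le hA1 (one_le_pow₀ (by linarith [norm_nonneg x]))
        calc _ ≤ C * (1 + ‖x‖) ^ l := hb j hjn x
          _ ≤ A * (1 + ‖x‖) ^ l := by gcongr; linarith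
          _ ≤ _ := le_self_pow₀ h1 (by omega))
    have hx : ‖x‖ ^ k ≤ (1 + ‖x‖) ^ k := by gcongr; linarith
    calc ‖x‖ ^ k * ‖iteratedFDeriv ℝ n (fun x : Config M => Real.exp (-(‖x‖ ^ 2 / 2))) x‖
        ≤ (1 + ‖x‖) ^ k * ((n ! : ℝ) * Real.exp (-(‖x‖ ^ 2 / 2)) * (A * (1 + ‖x‖) ^ l) ^ n) := by
          gcongr
          exact hcomp
      _ = (n ! : ℝ) * A ^ n * ((1 + ‖x‖) ^ (k + l * n) * Real.exp (-(‖x‖ ^ 2 / 2))) := by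
          rw [mul_pow, ← pow_mul, pow_add]; ring
      _ ≤ _ := by
          gcongr
          exact hK _ (norm_nonneg x)

theorem hasTemperateGrowth_coord {M : ℕ} (i : Fin M) :
    (fun x : Config M => (x i : ℝ)).HasTemperateGrowth :=
  (EuclideanSpace.proj (𝕜 := ℝ) i).hasTemperateGrowth

theorem hasTemperateGrowth_hermite {M : ℕ} (m : Fin M → ℕ) :
    (fun x : Config M => ∏ i, (Real.sqrt ((m i)! * Real.sqrt Real.pi))⁻¹
      * Polynomial.aeval (Real.sqrt 2 * x i) (Polynomial.hermite (m i))).HasTemperateGrowth := by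
  have hpoly : ∀ (p : Polynomial ℤ) (i : Fin M),
      (fun x : Config M => Polynomial.aeval (Real.sqrt 2 * x i) p).HasTemperateGrowth := by
    intro p i
    induction p using Polynomial.induction_on' with
    | add p q hp hq => simpa [Pi.add_def] using hp.add hq
    | monomial n a =>
      have h := (Function.HasTemperateGrowth.const (E := Config M) (a : ℝ)).mul
        (((Function.HasTemperateGrowth.const (E := Config M) (Real.sqrt 2)).mul
          (hasTemperateGrowth_coord i)).pow n)
      simpa [Polynomial.aeval_monomial, Pi.mul_def, Pi.pow_def] using h
  have hprod : ∀ s : Finset (Fin M),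
      (fun x : Config M => ∏ i ∈ s, (Real.sqrt ((m i)! * Real.sqrt Real.pi))⁻¹
        * Polynomial.aeval (Real.sqrt 2 * x i) (Polynomial.hermite (m i))).HasTemperateGrowth := by
    intro s
    induction s using Finset.induction_on with
    | empty => simp
    | insert i s hi ih =>
      simp only [Finset.prod_insert hi]
      exact ((Function.HasTemperateGrowth.const _).mul (hpoly _ i)).mul ih
  exact hprod Finset.univ

/-- The basis vector `|m₁⟩ ⊗ |b₁⟩ ⊗ ⋯ ⊗ |m_M⟩ ⊗ |b_M⟩`, as the Schwartz function
`x ↦ h_{m₁}(x₁) ⋯ h_{m_M}(x_M) |b₁ … b_M⟩` (see `ket_apply`). -/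
def ket {M : ℕ} (m : Fin M → ℕ) (b : Fin M → Fin 2) : 𝓢(Config M, Atoms M) :=
  SchwartzMap.postcompCLM (𝕜 := ℝ)
    ((ContinuousLinearMap.id ℝ ℝ).smulRight (EuclideanSpace.single b (1 : ℂ)))
    (SchwartzMap.smulLeftCLM ℝ (fun x : Config M => ∏ i,
      (Real.sqrt ((m i)! * Real.sqrt Real.pi))⁻¹
        * Polynomial.aeval (Real.sqrt 2 * x i) (Polynomial.hermite (m i))) (gaussian M))

theorem ket_apply {M : ℕ} (m : Fin M → ℕ) (b : Fin M → Fin 2) (x : Config M) :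
    ket m b x = (∏ i, hermiteFn (m i) (x i)) • EuclideanSpace.single b (1 : ℂ) := by
  have hg : gaussian M x = ∏ i, Real.exp (-(x i ^ 2 / 2)) := by
    change Real.exp (-(‖x‖ ^ 2 / 2)) = _
    rw [← Real.exp_sum, EuclideanSpace.real_norm_sq_eq, Finset.sum_neg_distrib, Finset.sum_div]
  rw [ket, SchwartzMap.postcompCLM_apply,
    SchwartzMap.smulLeftCLM_apply_apply (hasTemperateGrowth_hermite m), hg]
  simp [hermiteFn, Finset.prod_mul_distrib]

/-- The finite excitation subspace: the linear span of the basis vectors, inside the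
Schwartz space `𝓢(ℝ^M; (ℂ²)^{⊗ M})`. -/
def finiteExcitation (M : ℕ) : Submodule ℂ 𝓢(Config M, Atoms M) :=
  Submodule.span ℂ (Set.range fun p : (Fin M → ℕ) × (Fin M → Fin 2) => ket p.1 p.2)

/-- The inclusion of the Schwartz space into the Hilbert space. -/
def toL2 (M : ℕ) : 𝓢(Config M, Atoms M) →ₗ[ℂ] HilbertSpace M :=
  (SchwartzMap.toLpCLM ℂ (Atoms M) 2
    (MeasureTheory.volume : MeasureTheory.Measure (Config M))).toLinearMap

theorem toL2_injective (M : ℕ) : Function.Injective (toL2 M) :=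
  SchwartzMap.injective_toLp (E := Config M) (F := Atoms M) 2 MeasureTheory.volume

/-- The unbounded operator on the Hilbert space with domain the finite excitation subspace which
acts there as the operator `T` on Schwartz functions. -/
def onFiniteExcitation {M : ℕ} (T : 𝓢(Config M, Atoms M) →L[ℂ] 𝓢(Config M, Atoms M)) :
    HilbertSpace M →ₗ.[ℂ] HilbertSpace M where
  domain := (finiteExcitation M).map (toL2 M)
  toFun := toL2 M ∘ₗ T.toLinearMap ∘ₗ (finiteExcitation M).subtype ∘ₗ
    ((finiteExcitation M).equivMapOfInjective (toL2 M) (toL2_injective M)).symm.toLinearMap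

theorem onFiniteExcitation_apply {M : ℕ}
    (T : 𝓢(Config M, Atoms M) →L[ℂ] 𝓢(Config M, Atoms M)) (f : finiteExcitation M) :
    onFiniteExcitation T ⟨toL2 M f, Submodule.mem_map_of_mem f.2⟩ = toL2 M (T f) := by
  have h : ((finiteExcitation M).equivMapOfInjective (toL2 M) (toL2_injective M)).symm
      ⟨toL2 M f, Submodule.mem_map_of_mem f.2⟩ = f := by
    rw [LinearEquiv.symm_apply_eq]
    rfl
  change toL2 M (T ((((finiteExcitation M).equivMapOfInjective (toL2 M)
    (toL2_injective M)).symm ⟨toL2 M f, Submodule.mem_map_of_mem f.2⟩ : finiteExcitation M))) = _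
  rw [h]

/-! ### The operators of the model -/

/-- Multiplication by the coordinate `x_i`. -/
def position {M : ℕ} (i : Fin M) : 𝓢(Config M, Atoms M) →L[ℂ] 𝓢(Config M, Atoms M) :=
  SchwartzMap.smulLeftCLM (Atoms M) fun x : Config M => ((x i : ℝ) : ℂ)

theorem position_apply {M : ℕ} (i : Fin M) (f : 𝓢(Config M, Atoms M)) (x : Config M) :
    position i f x = ((x i : ℝ) : ℂ) • f x :=
  SchwartzMap.smulLeftCLM_apply_apply
    (Function.HasTemperateGrowth.comp Function.Complex.hasTemperateGrowth_ofReal (hasTemperateGrowth_coord i)) f x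

/-- The partial derivative `∂ / ∂x_i`. -/
def partialDeriv {M : ℕ} (i : Fin M) : 𝓢(Config M, Atoms M) →L[ℂ] 𝓢(Config M, Atoms M) :=
  LineDeriv.lineDerivOpCLM ℂ 𝓢(Config M, Atoms M) (EuclideanSpace.single i (1 : ℝ))

/-- The bosonic annihilation operator `a_i = (x_i + ∂_i) / √2`. -/
def annihilation {M : ℕ} (i : Fin M) : 𝓢(Config M, Atoms M) →L[ℂ] 𝓢(Config M, Atoms M) :=
  ((Real.sqrt 2 : ℝ) : ℂ)⁻¹ • (position i + partialDeriv i)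

/-- The bosonic creation operator `a_i^* = (x_i - ∂_i) / √2`. -/
def creation {M : ℕ} (i : Fin M) : 𝓢(Config M, Atoms M) →L[ℂ] 𝓢(Config M, Atoms M) :=
  ((Real.sqrt 2 : ℝ) : ℂ)⁻¹ • (position i - partialDeriv i)

/- The Pauli matrices. Rows and columns are indexed by the excitation number `0, 1`, i.e. they
are the usual Pauli matrices with respect to the ordered basis `(|1⟩, |0⟩)` of `ℂ²`, so that
`σz |1⟩ = |1⟩`, `σz |0⟩ = -|0⟩`. -/

/-- Pauli matrix `σˣ`. -/
def σx : Matrix (Fin 2) (Fin 2) ℂ := !![0, 1; 1, 0]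

/-- Pauli matrix `σʸ`. -/
def σy : Matrix (Fin 2) (Fin 2) ℂ := !![0, Complex.I; -Complex.I, 0]

/-- Pauli matrix `σᶻ`. -/
def σz : Matrix (Fin 2) (Fin 2) ℂ := !![-1, 0; 0, 1]

/-- `σ⁺ = (σˣ + i σʸ) / 2`, which maps `|0⟩` to `|1⟩` and `|1⟩` to `0`. -/
def σplus : Matrix (Fin 2) (Fin 2) ℂ := (2 : ℂ)⁻¹ • (σx + Complex.I • σy)

/-- `σ⁻ = (σˣ - i σʸ) / 2`, which maps `|1⟩` to `|0⟩` and `|0⟩` to `0`. -/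
def σminus : Matrix (Fin 2) (Fin 2) ℂ := (2 : ℂ)⁻¹ • (σx - Complex.I • σy)

theorem σplus_eq : σplus = !![0, 0; 1, 0] := by
  ext i j
  fin_cases i <;> fin_cases j <;> (simp [σplus, σx, σy]; try norm_num)

theorem σminus_eq : σminus = !![0, 1; 0, 0] := by
  ext i j
  fin_cases i <;> fin_cases j <;> (simp [σminus, σx, σy]; try norm_num)

/-- The matrix of `1 ⊗ ⋯ ⊗ A ⊗ ⋯ ⊗ 1` on `(ℂ²)^{⊗ M}`, with `A` in the `i`-th factor. -/
def siteMatrix {M : ℕ} (i : Fin M) (A : Matrix (Fin 2) (Fin 2) ℂ) :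
    Matrix (Fin M → Fin 2) (Fin M → Fin 2) ℂ :=
  Matrix.of fun b c => ∏ j, (if j = i then A else 1) (b j) (c j)

/-- The operator that acts as the `2 × 2` matrix `A` on the `i`-th atom and as the identity on
all other tensor factors. -/
def atomOp {M : ℕ} (i : Fin M) (A : Matrix (Fin 2) (Fin 2) ℂ) :
    𝓢(Config M, Atoms M) →L[ℂ] 𝓢(Config M, Atoms M) :=
  SchwartzMap.postcompCLM (Matrix.toEuclideanCLM (𝕜 := ℂ) (siteMatrix i A))

/-- `H_P = ∑ₖ ωPₖ aₖ* aₖ`. -/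
def freePhoton {M : ℕ} (ωP : Fin M → ℝ) : 𝓢(Config M, Atoms M) →L[ℂ] 𝓢(Config M, Atoms M) :=
  ∑ k, (ωP k : ℂ) • (creation k ∘L annihilation k)

/-- `H_A = ∑ₖ ωAₖ σᶻₖ`. -/
def freeAtom {M : ℕ} (ωA : Fin M → ℝ) : 𝓢(Config M, Atoms M) →L[ℂ] 𝓢(Config M, Atoms M) :=
  ∑ k, (ωA k : ℂ) • atomOp k σz

/-- `H_I = ∑ₖ ωIₖ (aₖ* σ⁻ₖ + aₖ σ⁺ₖ)`. -/
def interaction {M : ℕ} (ωI : Fin M → ℝ) : 𝓢(Config M, Atoms M) →L[ℂ] 𝓢(Config M, Atoms M) :=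
  ∑ k, (ωI k : ℂ) • (creation k ∘L atomOp k σminus + annihilation k ∘L atomOp k σplus)

/-- The drift Hamiltonian `H₀ = ∑ₖ (ωPₖ aₖ* aₖ + ωAₖ σᶻₖ + ωIₖ (aₖ* σ⁻ₖ + aₖ σ⁺ₖ))`, that is
`H_P + H_I + H_A`. -/
def drift {M : ℕ} (ωP ωA ωI : Fin M → ℝ) : 𝓢(Config M, Atoms M) →L[ℂ] 𝓢(Config M, Atoms M) :=
  freePhoton ωP + interaction ωI + freeAtom ωA

/-! ### Compact resolvent -/

/-- `R` is the resolvent of the unbounded operator `T` at `z`: a bounded operator that is a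
two-sided inverse of `z - T : dom T → H`. -/
def IsResolventAt {H : Type*} [NormedAddCommGroup H] [NormedSpace ℂ H]
    (T : H →ₗ.[ℂ] H) (z : ℂ) (R : H →L[ℂ] H) : Prop :=
  (∀ y : H, ∃ h : R y ∈ T.domain, z • R y - T ⟨R y, h⟩ = y) ∧
    ∀ x : T.domain, R (z • (x : H) - T x) = x

/-- `T` has compact resolvent: the resolvent of `T` exists at some real point, and at every point
of the resolvent set it is a compact operator. -/
def HasCompactResolvent {H : Type*} [NormedAddCommGroup H] [NormedSpace ℂ H]
    (T : H →ₗ.[ℂ] H) : Prop :=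
  (∃ (r : ℝ) (R : H →L[ℂ] H), IsResolventAt T (r : ℂ) R) ∧
    ∀ (z : ℂ) (R : H →L[ℂ] H), IsResolventAt T z R → IsCompactOperator R

end JCH

end

/-! The kets form a Hilbert basis in which `H_P` is diagonal, with eigenvalues `lam = ∑ ωP k * m k ≥
0` tending to infinity. Every other term sends each basis vector to a real multiple of its image
under an involution of the index set: the identity for `σz`, the flip of one atom for `σx`, and for
the coupling the exchange of a photon with an atomic excitation. The weights are invariant under
these involutions, which gives symmetry, and they are bounded or of order `√m`, hence
infinitesimally small relative to `lam`.

For large `s`, `-s - A` therefore factors on the span as `U` after multiplication by `-(lam + s)`,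
where `‖1 - U‖ < 1`. So `R = D U⁻¹`, with `D` the diagonal operator of entries `-(lam + s)⁻¹`, is a
bounded left inverse. It is symmetric, and compact because the entries of `D` tend to zero. Since
`-s - A` has dense range, the closure of `A` has the graph determined by `R`; symmetry of `R` makes
it self-adjoint, and the resolvent identity carries compactness to all other points
(`isSelfAdjoint_closure_and_hasCompactResolvent`).

Orthonormality of the kets follows from the ladder relations. For completeness, a vector orthogonal
to all kets has components whose products with the Gaussian have no moments; exponential decay makes
their Fourier transforms vanish (`ae_eq_zero_of_moments_eq_zero`). -/

namespace JCH

open scoped InnerProductSpace Topology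

/-! ### Self-adjointness and compactness from a bounded symmetric left inverse -/

section Resolvent

variable {H : Type*} [NormedAddCommGroup H] [InnerProductSpace ℂ H]

/-- The set of pairs `(x, y)` with `x = R (r x - y)`, which is the graph of `r - R⁻¹` for
injective `R`. -/
def resolventGraph (r : ℝ) (R : H →L[ℂ] H) : Submodule ℂ (H × H) :=
  LinearMap.eqLocus (LinearMap.fst ℂ H H)
    (R.toLinearMap ∘ₗ ((r : ℂ) • LinearMap.fst ℂ H H - LinearMap.snd ℂ H H))

theorem mem_resolventGraph {r : ℝ} {R : H →L[ℂ] H} {p : H × H} :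
    p ∈ resolventGraph r R ↔ p.1 = R ((r : ℂ) • p.1 - p.2) := by
  simp [resolventGraph, LinearMap.mem_eqLocus]

theorem apply_mem_resolventGraph (r : ℝ) (R : H →L[ℂ] H) (y : H) :
    (R y, (r : ℂ) • R y - y) ∈ resolventGraph r R := by
  simp [mem_resolventGraph]

theorem isClosed_resolventGraph (r : ℝ) (R : H →L[ℂ] H) :
    IsClosed (resolventGraph r R : Set (H × H)) := by
  have : (resolventGraph r R : Set (H × H)) = {p | p.1 = R ((r : ℂ) • p.1 - p.2)} := by
    ext p
    exact mem_resolventGraph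
  rw [this]
  exact isClosed_eq (by fun_prop) (by fun_prop)

variable {A : H →ₗ.[ℂ] H} {r : ℝ} {R : H →L[ℂ] H}

/-- The kernel of a symmetric `R` is orthogonal to its range, and the range contains the dense
domain of `A`. -/
theorem eq_zero_of_symmetric_of_leftInverse (hdom : Dense (A.domain : Set H))
    (hR : ∀ x y, ⟪R x, y⟫_ℂ = ⟪x, R y⟫_ℂ)
    (hRA : ∀ x : A.domain, R ((r : ℂ) • (x : H) - A x) = x) {y : H} (hy : R y = 0) : y = 0 := by
  refine hdom.eq_zero_of_inner_right ℂ fun x hx => ?_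
  have := hR ((r : ℂ) • x - A ⟨x, hx⟩) y
  rwa [hRA ⟨x, hx⟩, hy, inner_zero_right] at this

/-- One inclusion holds because the right side is closed. For the other, the continuous map `y ↦ (R
y, r R y - y)` parametrises the right side and sends the dense range of `r - A` into the graph of
`A`. -/
theorem graph_topologicalClosure_eq_resolventGraph
    (hRA : ∀ x : A.domain, R ((r : ℂ) • (x : H) - A x) = x)
    (hran : Dense (Set.range fun x : A.domain => (r : ℂ) • (x : H) - A x)) :
    A.graph.topologicalClosure = resolventGraph r R := by
  apply le_antisymm
  · refine Submodule.topologicalClosure_minimal _ ?_ (isClosed_resolventGraph r R)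
    intro p hp
    obtain ⟨x, h1, h2⟩ := (LinearPMap.mem_graph_iff _).1 hp
    rw [mem_resolventGraph, ← h1, ← h2, hRA]
  · intro p hp
    rw [mem_resolventGraph] at hp
    have hcont : Continuous fun y : H => (R y, (r : ℂ) • R y - y) := by fun_prop
    have := map_mem_closure hcont (hran ((r : ℂ) • p.1 - p.2))
      (t := (A.graph : Set (H × H))) (by
        rintro _ ⟨x, rfl⟩
        rw [SetLike.mem_coe, LinearPMap.mem_graph_iff]
        refine ⟨x, (hRA x).symm, ?_⟩
        simp only [hRA]
        abel)
    rw [← hp, sub_sub_cancel] at this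
    rwa [← SetLike.mem_coe, Submodule.topologicalClosure_coe]

theorem graph_closure_eq_resolventGraph (hdom : Dense (A.domain : Set H))
    (hR : ∀ x y, ⟪R x, y⟫_ℂ = ⟪x, R y⟫_ℂ)
    (hRA : ∀ x : A.domain, R ((r : ℂ) • (x : H) - A x) = x)
    (hran : Dense (Set.range fun x : A.domain => (r : ℂ) • (x : H) - A x)) :
    A.closure.graph = resolventGraph r R := by
  have hcl := graph_topologicalClosure_eq_resolventGraph hRA hran
  -- A point `(0, y)` of the closed graph satisfies `R y = 0`, so injectivity of `R` gives `y = 0`.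
  have hclosable : A.IsClosable := by
    refine ⟨(resolventGraph r R).toLinearPMap, ?_⟩
    rw [hcl, Submodule.toLinearPMap_graph_eq]
    intro p hp h0
    rw [mem_resolventGraph, h0, smul_zero, zero_sub, map_neg, eq_comm, neg_eq_zero] at hp
    exact eq_zero_of_symmetric_of_leftInverse hdom hR hRA hp
  rw [← hclosable.graph_closure_eq_closure_graph, hcl]

theorem isResolventAt_closure (hdom : Dense (A.domain : Set H))
    (hR : ∀ x y, ⟪R x, y⟫_ℂ = ⟪x, R y⟫_ℂ)
    (hRA : ∀ x : A.domain, R ((r : ℂ) • (x : H) - A x) = x)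
    (hran : Dense (Set.range fun x : A.domain => (r : ℂ) • (x : H) - A x)) :
    IsResolventAt A.closure (r : ℂ) R := by
  have hG := graph_closure_eq_resolventGraph hdom hR hRA hran
  constructor
  · intro y
    have hy := apply_mem_resolventGraph r R y
    rw [← hG, LinearPMap.mem_graph_iff] at hy
    obtain ⟨x, h1, h2⟩ := hy
    simp only at h1 h2
    have hmem : R y ∈ A.closure.domain := h1 ▸ x.2
    have hx : x = ⟨R y, hmem⟩ := Subtype.ext h1
    refine ⟨hmem, ?_⟩
    rw [← hx, h2]
    abel
  · intro x
    have hx := A.closure.mem_graph x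
    rw [hG, mem_resolventGraph] at hx
    exact hx.symm

variable [CompleteSpace H]

/-- A densely defined operator `A` such that `r - A` has dense range and a bounded symmetric
left inverse is essentially self-adjoint. -/
theorem isSelfAdjoint_closure_of_leftInverse (hdom : Dense (A.domain : Set H))
    (hR : ∀ x y, ⟪R x, y⟫_ℂ = ⟪x, R y⟫_ℂ)
    (hRA : ∀ x : A.domain, R ((r : ℂ) • (x : H) - A x) = x)
    (hran : Dense (Set.range fun x : A.domain => (r : ℂ) • (x : H) - A x)) :
    IsSelfAdjoint A.closure := by
  have hG := graph_closure_eq_resolventGraph hdom hR hRA hran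
  have hdom' : Dense (A.closure.domain : Set H) := hdom.mono A.le_closure.1
  rw [LinearPMap.isSelfAdjoint_def]
  apply LinearPMap.eq_of_eq_graph
  -- Testing the adjoint condition on the pairs `(R y, r R y - y)` and moving `R` across the inner
  -- product gives back the equation of `resolventGraph`, since `r` is real.
  rw [LinearPMap.adjoint_graph_eq_graph_adjoint hdom', hG]
  ext p
  rw [Submodule.mem_adjoint_iff, mem_resolventGraph]
  constructor
  · intro h
    refine ext_inner_left ℂ fun y => ?_
    have := h _ _ (apply_mem_resolventGraph r R y)
    rw [inner_sub_left, inner_smul_left, hR, hR, Complex.conj_ofReal] at this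
    rw [map_sub, map_smul, inner_sub_right, inner_smul_right]
    linear_combination -this
  · intro h a b hab
    rw [mem_resolventGraph] at hab
    simp only at hab
    have key := hR ((r : ℂ) • a - b) ((r : ℂ) • p.1 - p.2)
    rw [← h, ← hab, inner_sub_left, inner_sub_right, inner_smul_left, inner_smul_right,
      Complex.conj_ofReal] at key
    linear_combination key

end Resolvent

/-- If one resolvent is compact, then so is every other one. -/
theorem IsResolventAt.isCompactOperator {H : Type*} [NormedAddCommGroup H] [NormedSpace ℂ H]
    {T : H →ₗ.[ℂ] H} {w z : ℂ} {R S : H →L[ℂ] H} (hR : IsResolventAt T w R)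
    (hRc : IsCompactOperator R) (hS : IsResolventAt T z S) : IsCompactOperator S := by
  -- The resolvent identity exhibits `S` as the compact `R` composed with a bounded operator.
  have h : S = R ∘L (ContinuousLinearMap.id ℂ H + (w - z) • S) := by
    ext y
    obtain ⟨hy, hSy⟩ := hS.1 y
    have := hR.2 ⟨S y, hy⟩
    simp only at this
    have e : w • S y - T ⟨S y, hy⟩ = y + (w - z) • S y := by
      rw [sub_smul]
      nth_rewrite 3 [← hSy]
      abel
    rw [e] at this
    simpa using this.symm
  rw [h]
  exact hRc.comp_clm _

end JCH

/-! ### Weighted permutations and diagonal operators in a Hilbert basis -/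

namespace JCH

open scoped InnerProductSpace Topology
open Filter

section HilbertBasisOperators

variable {H ι : Type*} [NormedAddCommGroup H] [InnerProductSpace ℂ H]
  (e : HilbertBasis ι ℂ H)

theorem dense_span_hilbertBasis : Dense (Submodule.span ℂ (Set.range e) : Set H) :=
  Submodule.dense_iff_topologicalClosure_eq_top.2 e.dense_span

theorem inner_hilbertBasis [DecidableEq ι] (i j : ι) : ⟪e i, e j⟫_ℂ = if i = j then 1 else 0 :=
  orthonormal_iff_ite.1 e.orthonormal i j

theorem clm_ext_hilbertBasis {K L : H →L[ℂ] H} (h : ∀ j, K (e j) = L (e j)) : K = L := by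
  refine ContinuousLinearMap.ext_on (dense_span_hilbertBasis e) ?_
  rintro _ ⟨j, rfl⟩
  exact h j

variable [CompleteSpace H]

/-- Weighted permutations of a Hilbert basis are bounded operators. -/
theorem exists_clm_weightedPerm (π : Equiv.Perm ι) (c : ι → ℝ) {C : ℝ} (hC : 0 ≤ C)
    (hc : ∀ j, |c j| ≤ C) :
    ∃ K : H →L[ℂ] H, ‖K‖ ≤ C ∧ ∀ j, K (e j) = (c j : ℂ) • e (π j) := by
  classical
  -- The permuted family is again a Hilbert basis, so the operator is diagonal between two unitary
  -- coordinate maps, and its norm is controlled by the weights.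
  have hon : Orthonormal ℂ (e ∘ π) := e.orthonormal.comp π π.injective
  have hsp : ⊤ ≤ (Submodule.span ℂ (Set.range (e ∘ π))).topologicalClosure := by
    rw [π.surjective.range_comp, e.dense_span]
  let e' : HilbertBasis ι ℂ H := HilbertBasis.mk hon hsp
  let T : ι → ℂ →L[ℂ] ℂ := fun j => (c j : ℂ) • ContinuousLinearMap.id ℂ ℂ
  have hT : ∀ j, ‖T j‖ ≤ C := fun j => by
    refine (norm_smul_le (c j : ℂ) (ContinuousLinearMap.id ℂ ℂ)).trans ?_
    simpa using hc j
  let D := lp.mapCLM 2 T hC hT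
  have hD (j : ι) : D (lp.single 2 j (1 : ℂ) : lp (fun _ : ι => ℂ) 2)
      = (c j : ℂ) • (lp.single 2 j (1 : ℂ) : lp (fun _ : ι => ℂ) 2) := by
    ext i
    by_cases hij : i = j
    · subst hij
      simp [D, T, -Complex.coe_smul]
    · simp [D, T, Pi.single_eq_of_ne hij, -Complex.coe_smul]
  refine ⟨(e'.repr.symm.toContinuousLinearEquiv : _ →L[ℂ] H) ∘L D ∘L
    (e.repr.toContinuousLinearEquiv : H →L[ℂ] _), ?_, fun j => ?_⟩
  · refine ContinuousLinearMap.opNorm_le_bound _ hC fun x => ?_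
    simp only [ContinuousLinearMap.comp_apply, ContinuousLinearEquiv.coe_coe,
      LinearIsometryEquiv.coe_toContinuousLinearEquiv, LinearIsometryEquiv.norm_map]
    refine (D.le_of_opNorm_le (lp.norm_mapCLM_le 2 T hC hT) _).trans ?_
    rw [LinearIsometryEquiv.norm_map]
  · simp only [ContinuousLinearMap.comp_apply, ContinuousLinearEquiv.coe_coe,
      LinearIsometryEquiv.coe_toContinuousLinearEquiv, HilbertBasis.repr_self]
    rw [hD, map_smul, HilbertBasis.repr_symm_single]
    simp [e']

/-- A diagonal operator whose diagonal entries tend to zero is compact. -/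
theorem isCompactOperator_of_diagonal {w : ι → ℝ} (hw : Tendsto w cofinite (𝓝 0))
    {D : H →L[ℂ] H} (hD : ∀ j, D (e j) = (w j : ℂ) • e j) : IsCompactOperator D := by
  classical
  suffices D ∈ closure {f : H →L[ℂ] H | IsCompactOperator f} by
    rwa [isClosed_setOfPred_isCompactOperator.closure_eq] at this
  rw [Metric.mem_closure_iff]
  intro ε hε
  -- Compact operators are norm closed. Keeping the finitely many entries of size at least `ε / 2`
  -- gives a finite-rank operator, and the diagonal remainder has norm at most `ε / 2`.
  have hfin : {j | ¬ |w j| < ε / 2}.Finite := by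
    have := hw.eventually (Metric.ball_mem_nhds (0 : ℝ) (half_pos hε))
    simpa [Filter.eventually_cofinite, Real.norm_eq_abs] using this
  let F := hfin.toFinset
  let DF : H →L[ℂ] H := ∑ j ∈ F, (w j : ℂ) •
    (ContinuousLinearMap.toSpanSingleton ℂ (e j)) ∘L innerSL ℂ (e j)
  have hDF (j : ι) : DF (e j) = if j ∈ F then (w j : ℂ) • e j else 0 := by
    simp only [DF, sum_apply, smul_apply,
      ContinuousLinearMap.comp_apply, innerSL_apply_apply, inner_hilbertBasis,
      ContinuousLinearMap.toSpanSingleton_apply, ite_smul, one_smul, zero_smul, smul_ite,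
      smul_zero, Finset.sum_ite_eq']
  obtain ⟨K, hK, hKe⟩ := exists_clm_weightedPerm e 1 (fun j => if j ∈ F then 0 else w j)
    (half_pos hε).le (fun j => by
      by_cases hj : j ∈ F
      · simpa [hj] using (half_pos hε).le
      · simp only [hj, if_false]
        simp only [F, Set.Finite.mem_toFinset, Set.mem_ofPred_eq, not_not] at hj
        exact hj.le)
  refine ⟨DF, ?_, ?_⟩
  · refine Submodule.sum_mem (compactOperator (RingHom.id ℂ) H H) fun j _ => ?_
    refine Submodule.smul_mem _ _ ?_
    have h : IsCompactOperator (innerSL ℂ (e j)) :=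
      isCompactOperator_of_locallyCompactSpace_dom (innerSL ℂ (e j))
    exact h.clm_comp (ContinuousLinearMap.toSpanSingleton ℂ (e j))
  · have : D - DF = K := by
      refine clm_ext_hilbertBasis e fun j => ?_
      rw [sub_apply, hD, hDF, hKe]
      by_cases hj : j ∈ F <;> simp [hj]
    rw [dist_eq_norm, this]
    exact hK.trans_lt (half_lt_self hε)

end HilbertBasisOperators

/-! ### Relatively small perturbations of a diagonal operator -/

section Perturbation

variable {H ι L : Type*} [NormedAddCommGroup H] [InnerProductSpace ℂ H] [CompleteSpace H]
  [Fintype L]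

/-- A real diagonal operator with entries tending to infinity, perturbed by finitely many symmetric
weighted permutations with infinitesimally small relative weights, is essentially self-adjoint on
the span of the basis and has compact resolvent. -/
theorem isSelfAdjoint_closure_and_hasCompactResolvent (e : HilbertBasis ι ℂ H)
    {A : H →ₗ.[ℂ] H} (hdom : A.domain = Submodule.span ℂ (Set.range e))
    {lam : ι → ℝ} {π : L → Equiv.Perm ι} {c : L → ι → ℝ}
    (hA : ∀ j (h : e j ∈ A.domain),
      A ⟨e j, h⟩ = (lam j : ℂ) • e j + ∑ l, (c l j : ℂ) • e (π l j))
    (hlam0 : ∀ j, 0 ≤ lam j) (hlam : Tendsto lam cofinite atTop)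
    (hπ : ∀ l, Function.Involutive (π l)) (hc : ∀ l j, c l (π l j) = c l j)
    (hrel : ∀ l, ∀ ε > 0, ∃ s₀ : ℝ, ∀ s ≥ s₀, ∀ j, |c l j| ≤ ε * (lam j + s)) :
    IsSelfAdjoint A.closure ∧ HasCompactResolvent A.closure := by
  classical
  -- The choice gives `card L * ε < 1`, also for empty `L`, so that the sum of the relative
  -- perturbations is a strict contraction.
  set ε : ℝ := 1 / (2 * (Fintype.card L + 1)) with hε
  have hε0 : 0 < ε := by positivity
  choose s₀ hs₀ using fun l => hrel l ε hε0
  -- One shift serves all families; `1 ≤ s` also keeps the entries of `D` bounded by one.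
  obtain ⟨s, hs1, hsl⟩ : ∃ s : ℝ, 1 ≤ s ∧ ∀ l, s₀ l ≤ s := by
    refine ⟨1 + ∑ l, |s₀ l|, le_add_of_nonneg_right (by positivity), fun l => ?_⟩
    have := Finset.single_le_sum (f := fun l => |s₀ l|) (fun _ _ => abs_nonneg _)
      (Finset.mem_univ l)
    have h2 := le_abs_self (s₀ l)
    linarith
  have hμ (j : ι) : 0 < lam j + s := by linarith [hlam0 j]
  have hμ1 (j : ι) : 1 ≤ lam j + s := by linarith [hlam0 j]
  have hμC (j : ι) : (lam j : ℂ) + s ≠ 0 := by exact_mod_cast (hμ j).ne'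
  -- the relative perturbation
  have hKl (l : L) := exists_clm_weightedPerm e (π l) (fun j => -(c l j / (lam j + s))) hε0.le
    (fun j => by
      rw [abs_neg, abs_div, abs_of_pos (hμ j), div_le_iff₀ (hμ j)]
      exact hs₀ l s (hsl l) j)
  choose K hK hKe using hKl
  have hKnorm : ‖∑ l, K l‖ < 1 := by
    refine (norm_sum_le_of_le _ fun l _ => hK l).trans_lt ?_
    rw [Finset.sum_const, Finset.card_univ, nsmul_eq_mul, hε, mul_one_div,
      div_lt_one (by positivity)]
    have : (0 : ℝ) ≤ Fintype.card L := by positivity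
    linarith
  -- Neumann series: `U = 1 - ∑ K l` is invertible.
  let V : (H →L[ℂ] H)ˣ := Units.oneSub (∑ l, K l) hKnorm
  let U : H →L[ℂ] H := V
  let U' : H →L[ℂ] H := (V⁻¹ : (H →L[ℂ] H)ˣ)
  have hUU' (y : H) : U (U' y) = y := DFunLike.congr_fun V.mul_inv y
  have hU'U (y : H) : U' (U y) = y := DFunLike.congr_fun V.inv_mul y
  have hUe (j : ι) :
      U (e j) = e j + ∑ l, ((c l j / (lam j + s) : ℝ) : ℂ) • e (π l j) := by
    simp [U, V, hKe, Finset.sum_neg_distrib]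
  obtain ⟨D, -, hDe⟩ := exists_clm_weightedPerm e 1 (fun j => -(lam j + s)⁻¹) zero_le_one
    (fun j => by
      rw [abs_neg, abs_of_pos (inv_pos.2 (hμ j))]
      exact inv_le_one_of_one_le₀ (hμ1 j))
  have hDc : IsCompactOperator D := by
    refine isCompactOperator_of_diagonal e (w := fun j => -(lam j + s)⁻¹) ?_ hDe
    have h := (tendsto_atTop_add_const_right cofinite s hlam).inv_tendsto_atTop.neg
    simpa using h
  let R : H →L[ℂ] H := D ∘L U'
  have hRc : IsCompactOperator R := hDc.comp_clm _
  -- `U` intertwines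
  have hAe (j : ι) (h : e j ∈ A.domain) :
      ((-s : ℝ) : ℂ) • e j - A ⟨e j, h⟩ = -((lam j : ℂ) + s) • U (e j) := by
    rw [hA, hUe, smul_add, Finset.smul_sum]
    have : ∀ l, -((lam j : ℂ) + s) • ((c l j / (lam j + s) : ℝ) : ℂ) • e (π l j)
        = -((c l j : ℂ) • e (π l j)) := fun l => by
      rw [smul_smul, ← neg_smul]
      congr 1
      push_cast
      field_simp [hμC j]
    simp only [this, Finset.sum_neg_distrib]
    push_cast
    module
  -- Both sides have the same matrix entries: `π l` is an involution, so `i = π l j` exactly when `π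
  -- l i = j`, and then the weights agree. Substituting `U' x` and `U' y` turns this into the
  -- symmetry of `R = D U'`.
  have hDU : ContinuousLinearMap.adjoint D ∘L U = ContinuousLinearMap.adjoint U ∘L D := by
    refine clm_ext_hilbertBasis e fun j => ?_
    have key : ∀ i, ⟪e i, (ContinuousLinearMap.adjoint D ∘L U) (e j)⟫_ℂ
        = ⟪e i, (ContinuousLinearMap.adjoint U ∘L D) (e j)⟫_ℂ := fun i => by
      simp only [ContinuousLinearMap.comp_apply, ContinuousLinearMap.adjoint_inner_right, hDe,
        Equiv.Perm.one_apply, inner_smul_left, inner_smul_right, hUe, inner_add_left,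
        inner_add_right, inner_sum, sum_inner, Complex.conj_ofReal, inner_hilbertBasis,
        mul_add, Finset.mul_sum]
      congr 1
      · split_ifs with hij
        · rw [hij]
        · simp
      · refine Finset.sum_congr rfl fun l _ => ?_
        by_cases hij : i = π l j
        · have hji : π l i = j := by rw [hij, hπ l j]
          have hcl : c l i = c l j := by rw [hij, hc]
          rw [if_pos hij, if_pos hji, hcl]
          push_cast
          ring
        · have hji : π l i ≠ j := fun h => hij (by rw [← h, hπ l i])
          rw [if_neg hij, if_neg hji]
          simp
    exact (dense_span_hilbertBasis e).eq_of_inner_right ℂ fun v hv => by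
      induction hv using Submodule.span_induction with
      | mem x hx =>
        obtain ⟨i, rfl⟩ := hx
        exact key i
      | zero => simp
      | add x y _ _ hx hy => rw [inner_add_left, inner_add_left, hx, hy]
      | smul a x _ hx => rw [inner_smul_left, inner_smul_left, hx]
  have hsymm (x y : H) : ⟪R x, y⟫_ℂ = ⟪x, R y⟫_ℂ := by
    have h := congrArg (fun z => ⟪U' x, z⟫_ℂ) (DFunLike.congr_fun hDU (U' y))
    simpa only [ContinuousLinearMap.comp_apply, ContinuousLinearMap.adjoint_inner_right, hUU',
      R] using h
  have hRA (x : A.domain) : R (((-s : ℝ) : ℂ) • (x : H) - A x) = x := by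
    let G : A.domain →ₗ[ℂ] H := ((-s : ℝ) : ℂ) • A.domain.subtype - A.toFun
    suffices ∀ y ∈ Submodule.span ℂ (Set.range e), ∀ h : y ∈ A.domain, R (G ⟨y, h⟩) = y from
      this x (hdom ▸ x.2) x.2
    intro y hy
    induction hy using Submodule.span_induction with
    | mem x hx =>
      obtain ⟨j, rfl⟩ := hx
      intro h
      change R (((-s : ℝ) : ℂ) • e j - A ⟨e j, h⟩) = _
      rw [hAe, map_smul]
      simp only [R, ContinuousLinearMap.comp_apply, hU'U, hDe, Equiv.Perm.one_apply, smul_smul]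
      push_cast
      rw [neg_mul_neg, mul_inv_cancel₀ (hμC j), one_smul]
    | zero =>
      intro h
      have : (⟨0, h⟩ : A.domain) = 0 := rfl
      simp [this]
    | add x y hx hy ihx ihy =>
      intro h
      have hx' : x ∈ A.domain := hdom ▸ hx
      have hy' : y ∈ A.domain := hdom ▸ hy
      have : (⟨x + y, h⟩ : A.domain) = ⟨x, hx'⟩ + ⟨y, hy'⟩ := rfl
      rw [this, map_add, map_add, ihx, ihy]
    | smul a x hx ihx =>
      intro h
      have hx' : x ∈ A.domain := hdom ▸ hx
      have : (⟨a • x, h⟩ : A.domain) = a • ⟨x, hx'⟩ := rfl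
      rw [this, map_smul, map_smul, ihx]
  have hdense : Dense (A.domain : Set H) := hdom ▸ dense_span_hilbertBasis e
  have hran : Dense (Set.range fun x : A.domain => ((-s : ℝ) : ℂ) • (x : H) - A x) := by
    let G : A.domain →ₗ[ℂ] H := ((-s : ℝ) : ℂ) • A.domain.subtype - A.toFun
    -- `U (e j)` is the image of `-(lam j + s)⁻¹ • e j` under `-s - A`. Hence the range contains the
    -- image of a dense span under the continuous surjection `U`.
    have hle : Submodule.span ℂ (Set.range e) ≤ (LinearMap.range G).comap U.toLinearMap := by
      rw [Submodule.span_le]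
      rintro _ ⟨j, rfl⟩
      have h : e j ∈ A.domain := hdom ▸ Submodule.subset_span ⟨j, rfl⟩
      refine ⟨-((lam j : ℂ) + s)⁻¹ • ⟨e j, h⟩, ?_⟩
      rw [map_smul]
      change _ • (((-s : ℝ) : ℂ) • e j - A ⟨e j, h⟩) = U (e j)
      rw [hAe, smul_smul, neg_mul_neg, inv_mul_cancel₀ (hμC j), one_smul]
    have hUsurj : Function.Surjective U := fun y => ⟨U' y, hUU' y⟩
    refine (hUsurj.denseRange.dense_image U.continuous (dense_span_hilbertBasis e)).mono ?_
    rintro _ ⟨x, hx, rfl⟩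
    exact hle hx
  have hres := isResolventAt_closure hdense hsymm hRA hran
  exact ⟨isSelfAdjoint_closure_of_leftInverse hdense hsymm hRA hran, ⟨-s, R, hres⟩,
    fun z S hS => hres.isCompactOperator hRc hS⟩

end Perturbation

end JCH

/-! ### Hermite functions, ladder operators and atomic matrices -/

namespace JCH

/-- Differentiating the recursion `He_{n+1} = X He_n - He_n'` reduces the claim to the preceding
degree. -/
theorem derivative_hermite_succ (n : ℕ) :
    Polynomial.derivative (Polynomial.hermite (n + 1))
      = ((n : Polynomial ℤ) + 1) * Polynomial.hermite n := by
  induction n with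
  | zero => simp
  | succ n ih =>
    have h := Polynomial.hermite_succ n
    rw [Polynomial.hermite_succ (n + 1), ih]
    simp only [Polynomial.derivative_sub, Polynomial.derivative_mul, Polynomial.derivative_X, ih,
      Polynomial.derivative_add, Polynomial.derivative_natCast, Polynomial.derivative_one]
    rw [h]
    push_cast
    ring

theorem hasDerivAt_hermiteFn (n : ℕ) (t : ℝ) :
    HasDerivAt (hermiteFn n)
      ((Real.sqrt ((n ! : ℝ) * Real.sqrt Real.pi))⁻¹
        * (Real.sqrt 2 * Polynomial.aeval (Real.sqrt 2 * t)
            (Polynomial.derivative (Polynomial.hermite n)) * Real.exp (-(t ^ 2 / 2))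
          - t * Polynomial.aeval (Real.sqrt 2 * t) (Polynomial.hermite n)
            * Real.exp (-(t ^ 2 / 2)))) t := by
  have h1 : HasDerivAt (fun t : ℝ => Real.sqrt 2 * t) (Real.sqrt 2) t := by
    simpa using (hasDerivAt_id t).const_mul (Real.sqrt 2)
  have h2 := ((Polynomial.hermite n).hasDerivAt_aeval (Real.sqrt 2 * t)).comp t h1
  have h3 : HasDerivAt (fun t : ℝ => Real.exp (-(t ^ 2 / 2))) (Real.exp (-(t ^ 2 / 2)) * (-t)) t := by
    have : HasDerivAt (fun t : ℝ => -(t ^ 2 / 2)) (-t) t := by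
      refine (((hasDerivAt_id t).pow 2).div_const 2).neg.congr_deriv ?_
      simp
    exact this.exp
  have h4 := (h2.const_mul (Real.sqrt ((n ! : ℝ) * Real.sqrt Real.pi))⁻¹).mul h3
  refine h4.congr_deriv ?_
  simp only [Function.comp_apply]
  ring

/-- This ratio of normalising constants is the source of the square roots in the ladder relations.
-/
theorem hermiteFn_norm_succ (n : ℕ) :
    Real.sqrt (n + 1) * (Real.sqrt (((n + 1)! : ℕ) * Real.sqrt Real.pi))⁻¹
      = (Real.sqrt ((n ! : ℝ) * Real.sqrt Real.pi))⁻¹ := by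
  have h : (((n + 1)! : ℕ) : ℝ) * Real.sqrt Real.pi
      = (n + 1) * ((n ! : ℝ) * Real.sqrt Real.pi) := by
    rw [Nat.factorial_succ]
    push_cast
    ring
  have h0 : Real.sqrt ((n : ℝ) + 1) ≠ 0 := by positivity
  rw [h, Real.sqrt_mul (by positivity), mul_inv, mul_inv_cancel_left₀ h0]

/-- Raising relation for the Hermite functions. -/
theorem mul_hermiteFn_sub_deriv (n : ℕ) (t : ℝ) :
    t * hermiteFn n t - deriv (hermiteFn n) t
      = Real.sqrt 2 * (Real.sqrt (n + 1) * hermiteFn (n + 1) t) := by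
  have h2 : Real.sqrt 2 * Real.sqrt 2 = 2 := Real.mul_self_sqrt zero_le_two
  rw [(hasDerivAt_hermiteFn n t).deriv]
  simp only [hermiteFn, Polynomial.hermite_succ n, map_sub, map_mul, Polynomial.aeval_X]
  rw [← hermiteFn_norm_succ n]
  linear_combination (-Real.sqrt (n + 1) * (Real.sqrt (((n + 1)! : ℕ) * Real.sqrt Real.pi))⁻¹ * t *
    (Polynomial.aeval (Real.sqrt 2 * t) (Polynomial.hermite n)) * Real.exp (-(t ^ 2 / 2))) * h2

/-- Lowering relation for the Hermite functions. -/
theorem mul_hermiteFn_add_deriv (n : ℕ) (t : ℝ) :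
    t * hermiteFn n t + deriv (hermiteFn n) t
      = Real.sqrt 2 * (Real.sqrt n * hermiteFn (n - 1) t) := by
  rw [(hasDerivAt_hermiteFn n t).deriv]
  -- For `n = 0` the truncated index `n - 1` is harmless, since its coefficient `√0` vanishes.
  cases n with
  | zero => simp [hermiteFn]; ring
  | succ n =>
    have hn : Real.sqrt ((n : ℝ) + 1) * Real.sqrt (n + 1) = n + 1 :=
      Real.mul_self_sqrt (by positivity)
    simp only [hermiteFn, derivative_hermite_succ, map_mul, map_add, map_natCast, map_one,
      Nat.add_sub_cancel]
    rw [← hermiteFn_norm_succ n]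
    push_cast
    linear_combination (-Real.sqrt 2 * (Real.sqrt (((n + 1)! : ℕ) * Real.sqrt Real.pi))⁻¹ *
      (Polynomial.aeval (Real.sqrt 2 * t) (Polynomial.hermite n)) * Real.exp (-(t ^ 2 / 2))) * hn

section Ladder

variable {M : ℕ}

theorem prod_hermiteFn_update (m : Fin M → ℕ) (k : Fin M) (n : ℕ) (x : Fin M → ℝ) :
    ∏ j, hermiteFn (Function.update m k n j) (x j)
      = hermiteFn n (x k) * ∏ j ∈ Finset.univ.erase k, hermiteFn (m j) (x j) := by
  rw [← Finset.mul_prod_erase _ _ (Finset.mem_univ k), Function.update_self]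
  congr 1
  refine Finset.prod_congr rfl fun j hj => ?_
  rw [Function.update_of_ne (Finset.ne_of_mem_erase hj)]

theorem prod_hermiteFn (m : Fin M → ℕ) (k : Fin M) (x : Fin M → ℝ) :
    ∏ j, hermiteFn (m j) (x j)
      = hermiteFn (m k) (x k) * ∏ j ∈ Finset.univ.erase k, hermiteFn (m j) (x j) :=
  (Finset.mul_prod_erase _ _ (Finset.mem_univ k)).symm

theorem partialDeriv_ket_apply (k : Fin M) (m : Fin M → ℕ) (b : Fin M → Fin 2) (x : Config M) :
    partialDeriv k (ket m b) x
      = (deriv (hermiteFn (m k)) (x k) * ∏ j ∈ Finset.univ.erase k, hermiteFn (m j) (x j))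
        • EuclideanSpace.single b (1 : ℂ) := by
  change LineDeriv.lineDerivOp (EuclideanSpace.single k (1 : ℝ)) (ket m b) x = _
  rw [SchwartzMap.lineDerivOp_apply, lineDeriv]
  have hfun : (fun t : ℝ => ket m b (x + t • EuclideanSpace.single k (1 : ℝ)))
      = fun t : ℝ => (hermiteFn (m k) (x k + t)
        * ∏ j ∈ Finset.univ.erase k, hermiteFn (m j) (x j)) • EuclideanSpace.single b (1 : ℂ) := by
    funext t
    rw [ket_apply, prod_hermiteFn m k]
    congr 2
    · simp
    · refine Finset.prod_congr rfl fun j hj => ?_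
      simp [Finset.ne_of_mem_erase hj]
  rw [hfun]
  have h1 : HasDerivAt (fun t : ℝ => hermiteFn (m k) (x k + t)) (deriv (hermiteFn (m k)) (x k)) 0 := by
    have := (hasDerivAt_hermiteFn (m k) (x k)).differentiableAt.hasDerivAt
    rw [← add_zero (x k)] at this
    simpa using this.comp_const_add (x k) 0
  exact ((h1.mul_const _).smul_const _).deriv

theorem creation_apply (k : Fin M) (f : 𝓢(Config M, Atoms M)) (x : Config M) :
    creation k f x
      = ((Real.sqrt 2 : ℝ) : ℂ)⁻¹ • (((x k : ℝ) : ℂ) • f x - partialDeriv k f x) := by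
  rw [← position_apply]
  rfl

theorem annihilation_apply (k : Fin M) (f : 𝓢(Config M, Atoms M)) (x : Config M) :
    annihilation k f x
      = ((Real.sqrt 2 : ℝ) : ℂ)⁻¹ • (((x k : ℝ) : ℂ) • f x + partialDeriv k f x) := by
  rw [← position_apply]
  rfl

theorem creation_ket (k : Fin M) (m : Fin M → ℕ) (b : Fin M → Fin 2) :
    creation k (ket m b)
      = ((Real.sqrt (m k + 1) : ℝ) : ℂ) • ket (Function.update m k (m k + 1)) b := by
  have hs : ((Real.sqrt 2 : ℝ) : ℂ) ≠ 0 := by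
    exact_mod_cast (Real.sqrt_pos.2 zero_lt_two).ne'
  ext x c
  have key := congrArg Complex.ofReal (mul_hermiteFn_sub_deriv (m k) (x k))
  push_cast at key
  rw [smul_apply, creation_apply, partialDeriv_ket_apply, ket_apply, ket_apply,
    prod_hermiteFn_update, prod_hermiteFn m k]
  simp only [PiLp.smul_apply, PiLp.sub_apply, Complex.real_smul, smul_eq_mul]
  rw [inv_mul_eq_iff_eq_mul₀ hs]
  push_cast
  linear_combination ((∏ j ∈ Finset.univ.erase k, (hermiteFn (m j) (x j) : ℂ))
    * (EuclideanSpace.single b (1 : ℂ) : Atoms M) c) * key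

theorem annihilation_ket (k : Fin M) (m : Fin M → ℕ) (b : Fin M → Fin 2) :
    annihilation k (ket m b)
      = ((Real.sqrt (m k) : ℝ) : ℂ) • ket (Function.update m k (m k - 1)) b := by
  have hs : ((Real.sqrt 2 : ℝ) : ℂ) ≠ 0 := by
    exact_mod_cast (Real.sqrt_pos.2 zero_lt_two).ne'
  ext x c
  have key := congrArg Complex.ofReal (mul_hermiteFn_add_deriv (m k) (x k))
  push_cast at key
  rw [smul_apply, annihilation_apply, partialDeriv_ket_apply, ket_apply, ket_apply,
    prod_hermiteFn_update, prod_hermiteFn m k]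
  simp only [PiLp.smul_apply, PiLp.add_apply, Complex.real_smul, smul_eq_mul]
  rw [inv_mul_eq_iff_eq_mul₀ hs]
  push_cast
  linear_combination ((∏ j ∈ Finset.univ.erase k, (hermiteFn (m j) (x j) : ℂ))
    * (EuclideanSpace.single b (1 : ℂ) : Atoms M) c) * key

theorem creation_annihilation_ket (k : Fin M) (m : Fin M → ℕ) (b : Fin M → Fin 2) :
    creation k (annihilation k (ket m b)) = (m k : ℂ) • ket m b := by
  rw [annihilation_ket, map_smul]
  rcases Nat.eq_zero_or_pos (m k) with h | h
  · simp [h]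
  · have h1 : m k - 1 + 1 = m k := Nat.sub_add_cancel h
    have h2 : ((m k - 1 : ℕ) : ℝ) + 1 = m k := by exact_mod_cast h1
    rw [creation_ket, Function.update_self, Function.update_idem, h1, h2, Function.update_eq_self,
      smul_smul, ← Complex.ofReal_mul, Real.mul_self_sqrt (Nat.cast_nonneg _),
      Complex.ofReal_natCast]

theorem annihilation_creation_ket (k : Fin M) (m : Fin M → ℕ) (b : Fin M → Fin 2) :
    annihilation k (creation k (ket m b)) = ((m k : ℂ) + 1) • ket m b := by
  rw [creation_ket, map_smul, annihilation_ket, Function.update_self, Function.update_idem,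
    Nat.add_sub_cancel, Function.update_eq_self, smul_smul, ← Complex.ofReal_mul, Nat.cast_succ,
    Real.mul_self_sqrt (by positivity)]
  push_cast
  rfl

/-- The identity factors at the other sites kill every entry for which `c` differs from `b` away
from `k`. -/
theorem siteMatrix_apply (k : Fin M) (A : Matrix (Fin 2) (Fin 2) ℂ) (c b : Fin M → Fin 2) :
    siteMatrix k A c b = ∑ a, A a (b k) * if c = Function.update b k a then 1 else 0 := by
  rw [siteMatrix, Matrix.of_apply, ← Finset.mul_prod_erase _ _ (Finset.mem_univ k), if_pos rfl]
  by_cases h : ∀ j, j ≠ k → c j = b j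
  · have hc : c = Function.update b k (c k) := by
      rw [Function.eq_update_iff]
      exact ⟨rfl, h⟩
    have hprod : ∏ j ∈ Finset.univ.erase k, (if j = k then A else 1) (c j) (b j) = 1 := by
      refine Finset.prod_eq_one fun j hj => ?_
      have hj := Finset.ne_of_mem_erase hj
      rw [if_neg hj, h j hj, Matrix.one_apply_eq]
    have hiff (a : Fin 2) : c = Function.update b k a ↔ c k = a := by
      constructor
      · intro h
        rw [h, Function.update_self]
      · rintro rfl
        exact hc
    simp [hprod, hiff]
  · push Not at h
    obtain ⟨j, hj, hne⟩ := h
    rw [Finset.prod_eq_zero (Finset.mem_erase.2 ⟨hj, Finset.mem_univ j⟩)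
      (by rw [if_neg hj, Matrix.one_apply_ne hne]), mul_zero]
    refine (Finset.sum_eq_zero fun a _ => ?_).symm
    rw [if_neg, mul_zero]
    intro h
    exact hne (by rw [h, Function.update_of_ne hj])

theorem atomOp_ket (k : Fin M) (A : Matrix (Fin 2) (Fin 2) ℂ) (m : Fin M → ℕ)
    (b : Fin M → Fin 2) :
    atomOp k A (ket m b) = ∑ a, A a (b k) • ket m (Function.update b k a) := by
  ext x c
  have h1 : atomOp k A (ket m b) x = Matrix.toEuclideanCLM (𝕜 := ℂ) (siteMatrix k A) (ket m b x) :=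
    rfl
  rw [h1, sum_apply, ket_apply]
  simp only [smul_apply, ket_apply]
  rw [ContinuousLinearMap.map_smul_of_tower]
  rw [PiLp.smul_apply, WithLp.ofLp_sum, Finset.sum_apply, Matrix.ofLp_toEuclideanCLM]
  simp only [PiLp.smul_apply, PiLp.single_apply, PiLp.ofLp_single,
    Matrix.mulVec_single_one, Matrix.col_apply, siteMatrix_apply, Complex.real_smul, smul_eq_mul,
    Finset.mul_sum]
  refine Finset.sum_congr rfl fun a _ => ?_
  ring

end Ladder

end JCH

/-! ### Orthonormality of the kets -/

namespace JCH

open scoped InnerProductSpace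

section Orthonormality

variable {M : ℕ}

theorem inner_toL2 (f g : 𝓢(Config M, Atoms M)) :
    ⟪toL2 M f, toL2 M g⟫_ℂ = ∫ x, ⟪f x, g x⟫_ℂ :=
  SchwartzMap.inner_toL2_toL2_eq f g

theorem inner_position (k : Fin M) (f g : 𝓢(Config M, Atoms M)) :
    ⟪toL2 M (position k f), toL2 M g⟫_ℂ = ⟪toL2 M f, toL2 M (position k g)⟫_ℂ := by
  simp only [inner_toL2, position_apply, inner_smul_left, inner_smul_right, Complex.conj_ofReal]

/-- Integration by parts for Schwartz functions, with the inner product viewed as a real bilinear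
map. -/
theorem inner_partialDeriv (k : Fin M) (f g : 𝓢(Config M, Atoms M)) :
    ⟪toL2 M (partialDeriv k f), toL2 M g⟫_ℂ = -⟪toL2 M f, toL2 M (partialDeriv k g)⟫_ℂ := by
  have h := SchwartzMap.integral_bilinear_lineDerivOp_right_eq_neg_left
    (μ := MeasureTheory.volume) f g
    (isBoundedBilinearMap_inner (𝕜 := ℂ) (E := Atoms M)).toContinuousLinearMap
    (EuclideanSpace.single k (1 : ℝ))
  rw [inner_toL2, inner_toL2]
  exact (neg_eq_iff_eq_neg.2 h).symm

theorem inner_creation (k : Fin M) (f g : 𝓢(Config M, Atoms M)) :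
    ⟪toL2 M (creation k f), toL2 M g⟫_ℂ = ⟪toL2 M f, toL2 M (annihilation k g)⟫_ℂ := by
  have h1 : creation k f = ((Real.sqrt 2 : ℝ) : ℂ)⁻¹ • (position k f - partialDeriv k f) := rfl
  have h2 : annihilation k g = ((Real.sqrt 2 : ℝ) : ℂ)⁻¹ • (position k g + partialDeriv k g) := rfl
  rw [h1, h2, map_smul, map_smul, map_sub, map_add, inner_smul_left, inner_smul_right,
    inner_sub_left, inner_add_right, inner_position, inner_partialDeriv, map_inv₀,
    Complex.conj_ofReal, sub_neg_eq_add]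

theorem inner_annihilation (k : Fin M) (f g : 𝓢(Config M, Atoms M)) :
    ⟪toL2 M (annihilation k f), toL2 M g⟫_ℂ = ⟪toL2 M f, toL2 M (creation k g)⟫_ℂ := by
  rw [← inner_conj_symm, ← inner_creation, inner_conj_symm]

theorem inner_ket_of_ne_right (m n : Fin M → ℕ) {b c : Fin M → Fin 2} (h : b ≠ c) :
    ⟪toL2 M (ket m b), toL2 M (ket n c)⟫_ℂ = 0 := by
  rw [inner_toL2]
  have : ∀ x, ⟪ket m b x, ket n c x⟫_ℂ = 0 := fun x => by
    rw [ket_apply, ket_apply, ← Complex.coe_smul, ← Complex.coe_smul, inner_smul_left,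
      inner_smul_right, EuclideanSpace.inner_single_left, PiLp.single_apply, if_neg h]
    simp
  simp [this]

/-- Where `m` and `n` differ at `k`, the kets are eigenvectors of the symmetric operator `a_k* a_k`
with different eigenvalues. -/
theorem inner_ket_of_ne_left {m n : Fin M → ℕ} (b c : Fin M → Fin 2) (h : m ≠ n) :
    ⟪toL2 M (ket m b), toL2 M (ket n c)⟫_ℂ = 0 := by
  obtain ⟨k, hk⟩ := Function.ne_iff.1 h
  have h1 : ⟪toL2 M (creation k (annihilation k (ket m b))), toL2 M (ket n c)⟫_ℂ
      = ⟪toL2 M (ket m b), toL2 M (creation k (annihilation k (ket n c)))⟫_ℂ := by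
    rw [inner_creation, inner_annihilation]
  rw [creation_annihilation_ket, creation_annihilation_ket, map_smul, map_smul, inner_smul_left,
    inner_smul_right, Complex.conj_natCast, ← sub_eq_zero, ← sub_mul, mul_eq_zero] at h1
  refine h1.resolve_left ?_
  rw [sub_eq_zero]
  exact_mod_cast hk

theorem ket_zero_apply (b : Fin M → Fin 2) (x : Config M) :
    ket 0 b x = ((Real.sqrt (Real.sqrt Real.pi))⁻¹ ^ M * Real.exp (-(‖x‖ ^ 2 / 2)))
      • EuclideanSpace.single b (1 : ℂ) := by
  rw [ket_apply, EuclideanSpace.real_norm_sq_eq, Finset.sum_div, ← Finset.sum_neg_distrib,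
    Real.exp_sum]
  simp [hermiteFn, Finset.prod_mul_distrib]

theorem inner_ket_zero_self (b : Fin M → Fin 2) :
    ⟪toL2 M (ket 0 b), toL2 M (ket 0 b)⟫_ℂ = 1 := by
  have hpi := Real.pi_pos
  have hpt : ∀ x : Config M, ⟪ket 0 b x, ket 0 b x⟫_ℂ
      = (((Real.sqrt Real.pi)⁻¹ ^ M * Real.exp (-1 * ‖x‖ ^ 2) : ℝ) : ℂ) := fun x => by
    have h1 : Real.exp (-1 * ‖x‖ ^ 2)
        = Real.exp (-(‖x‖ ^ 2 / 2)) * Real.exp (-(‖x‖ ^ 2 / 2)) := by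
      rw [← Real.exp_add]
      congr 1
      ring
    have h2 : (Real.sqrt Real.pi)⁻¹
        = (Real.sqrt (Real.sqrt Real.pi))⁻¹ * (Real.sqrt (Real.sqrt Real.pi))⁻¹ := by
      rw [← mul_inv, Real.mul_self_sqrt (Real.sqrt_nonneg _)]
    rw [ket_zero_apply, ← Complex.coe_smul, inner_smul_left, inner_smul_right,
      EuclideanSpace.inner_single_left, PiLp.single_apply, if_pos rfl, h1, h2, mul_pow]
    simp only [Complex.conj_ofReal, map_one]
    push_cast
    ring
  rw [inner_toL2, MeasureTheory.integral_congr_ae (Filter.Eventually.of_forall hpt),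
    integral_complex_ofReal, MeasureTheory.integral_const_mul,
    GaussianFourier.integral_rexp_neg_mul_sq_norm one_pos, finrank_euclideanSpace_fin, div_one,
    Real.sqrt_eq_rpow, inv_pow, ← Real.rpow_natCast, ← Real.rpow_mul hpi.le,
    one_div_mul_eq_div, inv_mul_cancel₀ (Real.rpow_pos_of_pos hpi _).ne', Complex.ofReal_one]

/-- Induction on the total photon number from the Gaussian ground state: `a_k a_k* = m_k + 1` on
kets, so raising with factor `√(m_k + 1)` preserves the norm. -/
theorem inner_ket_self (m : Fin M → ℕ) (b : Fin M → Fin 2) :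
    ⟪toL2 M (ket m b), toL2 M (ket m b)⟫_ℂ = 1 := by
  induction hN : ∑ j, m j generalizing m with
  | zero =>
    have : m = 0 := by
      funext j
      exact (Finset.sum_eq_zero_iff.1 hN) j (Finset.mem_univ j)
    rw [this, inner_ket_zero_self]
  | succ N ih =>
    obtain ⟨k, -, hk⟩ : ∃ k ∈ Finset.univ, m k ≠ 0 := Finset.exists_ne_zero_of_sum_ne_zero (by omega)
    have hk1 : m k - 1 + 1 = m k := Nat.sub_add_cancel (Nat.pos_of_ne_zero hk)
    set m' := Function.update m k (m k - 1) with hm'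
    have hm'k : m' k = m k - 1 := Function.update_self ..
    have hm : Function.update m' k (m' k + 1) = m := by
      rw [hm'k, hk1, hm', Function.update_idem, Function.update_eq_self]
    have hsum : ∑ j, m' j = N := by
      rw [Finset.sum_update_of_mem (Finset.mem_univ k)]
      rw [Finset.sum_eq_add_sum_sdiff_singleton_of_mem (Finset.mem_univ k)] at hN
      omega
    have h := inner_creation k (ket m' b) (creation k (ket m' b))
    have hs : ((Real.sqrt (m' k + 1) : ℝ) : ℂ) * ((Real.sqrt (m' k + 1) : ℝ) : ℂ)
        = (m' k : ℂ) + 1 := by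
      rw [← Complex.ofReal_mul, Real.mul_self_sqrt (by positivity)]
      push_cast
      rfl
    have h0 : (m' k : ℂ) + 1 ≠ 0 := Nat.cast_add_one_ne_zero _
    rw [annihilation_creation_ket, creation_ket, hm, map_smul, map_smul, inner_smul_left,
      inner_smul_right, inner_smul_right, ih m' hsum, Complex.conj_ofReal, ← mul_assoc, hs] at h
    exact mul_left_cancel₀ h0 h

theorem orthonormal_ket :
    Orthonormal ℂ fun p : (Fin M → ℕ) × (Fin M → Fin 2) => toL2 M (ket p.1 p.2) := by
  classical
  rw [orthonormal_iff_ite]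
  rintro ⟨m, b⟩ ⟨n, c⟩
  split_ifs with h
  · obtain ⟨rfl, rfl⟩ := Prod.mk.inj h
    exact inner_ket_self m b
  · by_cases hb : b = c
    · exact inner_ket_of_ne_left b c fun hm => h (Prod.ext hm hb)
    · exact inner_ket_of_ne_right m n hb

end Orthonormality

end JCH

/-! ### Vanishing moments and the Fourier transform -/

namespace JCH

open scoped InnerProductSpace FourierTransform
open MeasureTheory

section FourierMoments

variable {V : Type*} [NormedAddCommGroup V] [InnerProductSpace ℝ V] [FiniteDimensional ℝ V]
  [MeasurableSpace V] [BorelSpace V]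

/-- A function with vanishing Fourier transform vanishes almost everywhere. -/
theorem ae_eq_zero_of_fourier_eq_zero {G : V → ℂ} (hG : Integrable G) (h : ∀ ξ, 𝓕 G ξ = 0) :
    ∀ᵐ x, G x = 0 := by
  refine ae_eq_zero_of_integral_contDiff_smul_eq_zero hG.locallyIntegrable fun ψ hψ hψc => ?_
  have h1 : HasCompactSupport (Complex.ofRealCLM ∘ ψ) := hψc.comp_left rfl
  have h2 : ContDiff ℝ ∞ (Complex.ofRealCLM ∘ ψ) := by fun_prop
  -- The test function is the Fourier transform of a Schwartz function, so the transform can be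
  -- moved onto `G`, where it vanishes.
  let u : 𝓢(V, ℂ) := h1.toSchwartzMap h2
  have hu : 𝓕 (𝓕⁻ u) = u := FourierTransform.fourier_fourierInv_eq u
  have hflip : ∫ x, 𝓕 (𝓕⁻ u : 𝓢(V, ℂ)) x • G x = ∫ x, (𝓕⁻ u : 𝓢(V, ℂ)) x • 𝓕 G x := by
    have := VectorFourier.integral_fourierIntegral_smul_eq_flip (L := innerₗ V)
      Real.continuous_fourierChar continuous_inner ((𝓕⁻ u : 𝓢(V, ℂ)).integrable (μ := volume)) hG
    rwa [flip_innerₗ] at this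
  rw [hu] at hflip
  calc ∫ x, ψ x • G x = ∫ x, u x • G x := by
        refine integral_congr_ae (Filter.Eventually.of_forall fun x => ?_)
        change ψ x • G x = (ψ x : ℂ) • G x
        rw [Complex.coe_smul]
    _ = 0 := by
        rw [hflip]
        simp [h]

/-- A function with exponential moments all of whose directional moments vanish is zero almost
everywhere. -/
theorem ae_eq_zero_of_moments_eq_zero {G : V → ℂ} (hG : AEStronglyMeasurable G)
    (hexp : ∀ a : ℝ, Integrable fun x => Real.exp (a * ‖x‖) * ‖G x‖)
    (hmom : ∀ (ξ : V) (n : ℕ), ∫ x, (((⟪x, ξ⟫_ℝ : ℝ) : ℂ) ^ n) * G x = 0) :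
    ∀ᵐ x, G x = 0 := by
  have hGint : Integrable G := by
    rw [← integrable_norm_iff hG]
    simpa using hexp 0
  refine ae_eq_zero_of_fourier_eq_zero hGint fun ξ => ?_
  have hb (x : V) : HasSum (fun n : ℕ => (2 * Real.pi * ‖ξ‖ * ‖x‖) ^ n / n ! * ‖G x‖)
      (Real.exp (2 * Real.pi * ‖ξ‖ * ‖x‖) * ‖G x‖) := by
    have := NormedSpace.expSeries_div_hasSum_exp (𝔸 := ℝ) (2 * Real.pi * ‖ξ‖ * ‖x‖)
    rw [← Real.exp_eq_exp_ℝ] at this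
    exact this.mul_right _
  -- The Fourier character is expanded in its power series and integrated termwise. The norms of the
  -- terms sum to at most `exp (2π ‖ξ‖ ‖x‖) ‖G x‖`, which is integrable; each term is a multiple of
  -- a moment.
  have hsum := hasSum_integral_of_dominated_convergence (μ := (volume : Measure V))
    (F := fun (n : ℕ) x =>
      (-(2 * Real.pi * Complex.I) * ((⟪x, ξ⟫_ℝ : ℝ) : ℂ)) ^ n / (n ! : ℂ) * G x)
    (f := fun x => Complex.exp (-(2 * Real.pi * Complex.I) * ((⟪x, ξ⟫_ℝ : ℝ) : ℂ)) * G x)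
    (fun n x => (2 * Real.pi * ‖ξ‖ * ‖x‖) ^ n / n ! * ‖G x‖)
    (fun n => by
      refine AEStronglyMeasurable.mul (Continuous.aestronglyMeasurable ?_) hG
      fun_prop)
    (fun n => Filter.Eventually.of_forall fun x => by
      rw [norm_mul, norm_div, norm_pow, norm_mul, Complex.norm_natCast, Complex.norm_real]
      have h1 : ‖-(2 * (Real.pi : ℂ) * Complex.I)‖ = 2 * Real.pi := by
        simp [abs_of_pos Real.pi_pos]
      have h2 : ‖⟪x, ξ⟫_ℝ‖ ≤ ‖ξ‖ * ‖x‖ := by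
        rw [mul_comm]
        exact norm_inner_le_norm x ξ
      rw [h1, mul_assoc (2 * Real.pi)]
      gcongr)
    (Filter.Eventually.of_forall fun x => (hb x).summable)
    (by
      simp only [fun x => (hb x).tsum_eq]
      exact hexp _)
    (Filter.Eventually.of_forall fun x => by
      have := NormedSpace.expSeries_div_hasSum_exp (𝔸 := ℂ)
        (-(2 * Real.pi * Complex.I) * ((⟪x, ξ⟫_ℝ : ℝ) : ℂ))
      rw [← Complex.exp_eq_exp_ℂ] at this
      exact this.mul_right _)
  have hzero : ∀ n : ℕ, ∫ x, (-(2 * Real.pi * Complex.I) * ((⟪x, ξ⟫_ℝ : ℝ) : ℂ)) ^ n / (n ! : ℂ)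
      * G x = 0 := fun n => by
    have : ∀ x, (-(2 * Real.pi * Complex.I) * ((⟪x, ξ⟫_ℝ : ℝ) : ℂ)) ^ n / (n ! : ℂ) * G x
        = ((-(2 * Real.pi * Complex.I)) ^ n / (n ! : ℂ)) * (((⟪x, ξ⟫_ℝ : ℝ) : ℂ) ^ n * G x) :=
      fun x => by
        rw [mul_pow]
        ring
    simp only [this]
    rw [integral_const_mul, hmom, mul_zero]
  simp only [hzero] at hsum
  rw [Real.fourier_eq]
  refine Eq.trans ?_ (hsum.unique hasSum_zero)
  refine integral_congr_ae (Filter.Eventually.of_forall fun x => ?_)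
  simp only [Circle.smul_def, Real.fourierChar_apply, smul_eq_mul]
  congr 2
  push_cast
  ring

end FourierMoments

/-! ### Completeness of the kets -/

section Completeness

variable {M : ℕ}

theorem ket_mem_finiteExcitation (m : Fin M → ℕ) (b : Fin M → Fin 2) :
    ket m b ∈ finiteExcitation M :=
  Submodule.subset_span ⟨(m, b), rfl⟩

theorem map_mem_finiteExcitation {T : 𝓢(Config M, Atoms M) →L[ℂ] 𝓢(Config M, Atoms M)}
    (hT : ∀ m b, T (ket m b) ∈ finiteExcitation M) {f : 𝓢(Config M, Atoms M)}
    (hf : f ∈ finiteExcitation M) : T f ∈ finiteExcitation M := by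
  have : finiteExcitation M ≤ (finiteExcitation M).comap T.toLinearMap := by
    refine Submodule.span_le.2 ?_
    rintro _ ⟨p, rfl⟩
    exact hT p.1 p.2
  exact this hf

/-- `x_k = (a_k + a_k*) / √2`, and both ladder operators send kets to multiples of kets. Thus
polynomial multiples of the ground state stay in the span. -/
theorem position_mem_finiteExcitation (k : Fin M) {f : 𝓢(Config M, Atoms M)}
    (hf : f ∈ finiteExcitation M) : position k f ∈ finiteExcitation M := by
  have h2 : ((Real.sqrt 2 : ℝ) : ℂ) * ((Real.sqrt 2 : ℝ) : ℂ) = 2 := by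
    rw [← Complex.ofReal_mul, Real.mul_self_sqrt zero_le_two, Complex.ofReal_ofNat]
  have h0 : ((Real.sqrt 2 : ℝ) : ℂ) ≠ 0 := by
    exact_mod_cast (Real.sqrt_pos.2 zero_lt_two).ne'
  have hpos (g : 𝓢(Config M, Atoms M)) :
      position k g = ((Real.sqrt 2 : ℝ) : ℂ)⁻¹ • (creation k g + annihilation k g) := by
    have h1 : creation k g = ((Real.sqrt 2 : ℝ) : ℂ)⁻¹ • (position k g - partialDeriv k g) := rfl
    have h3 : annihilation k g = ((Real.sqrt 2 : ℝ) : ℂ)⁻¹ • (position k g + partialDeriv k g) :=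
      rfl
    have h4 : ((Real.sqrt 2 : ℝ) : ℂ)⁻¹ * ((Real.sqrt 2 : ℝ) : ℂ)⁻¹ = 2⁻¹ := by
      rw [← mul_inv, h2]
    rw [h1, h3, ← smul_add, smul_smul, h4]
    module
  refine map_mem_finiteExcitation (fun m b => ?_) hf
  rw [hpos, creation_ket, annihilation_ket]
  exact Submodule.smul_mem _ _ (Submodule.add_mem _
    (Submodule.smul_mem _ _ (ket_mem_finiteExcitation _ _))
    (Submodule.smul_mem _ _ (ket_mem_finiteExcitation _ _)))

theorem exists_mem_finiteExcitation_inner_pow (b : Fin M → Fin 2) (ξ : Config M) (n : ℕ) :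
    ∃ f ∈ finiteExcitation M, ∀ x, f x = (((⟪x, ξ⟫_ℝ : ℝ) : ℂ) ^ n) • ket 0 b x := by
  induction n with
  | zero => exact ⟨ket 0 b, ket_mem_finiteExcitation _ _, fun x => by simp⟩
  | succ n ih =>
    obtain ⟨f, hf, hfx⟩ := ih
    refine ⟨∑ k, ((ξ k : ℝ) : ℂ) • position k f, Submodule.sum_mem _ fun k _ =>
      Submodule.smul_mem _ _ (position_mem_finiteExcitation k hf), fun x => ?_⟩
    have hinner : ((⟪x, ξ⟫_ℝ : ℝ) : ℂ) = ∑ k, ((ξ k : ℝ) : ℂ) * ((x k : ℝ) : ℂ) := by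
      rw [PiLp.inner_apply]
      push_cast
      simp
    rw [sum_apply]
    simp only [smul_apply, position_apply, hfx, smul_smul]
    rw [← Finset.sum_smul, pow_succ, hinner, Finset.mul_sum]
    congr 1
    exact Finset.sum_congr rfl fun k _ => by ring

theorem integrable_exp_mul_gaussian (a : ℝ) :
    Integrable fun x : Config M => Real.exp (a * ‖x‖ - ‖x‖ ^ 2) := by
  have h := (gaussian M).integrable (μ := volume)
  -- The constant comes from completing the square: `a ‖x‖ ≤ a² / 2 + ‖x‖² / 2`.
  refine (h.const_mul (Real.exp (a ^ 2 / 2))).mono' (by fun_prop)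
    (Filter.Eventually.of_forall fun x => ?_)
  change ‖_‖ ≤ Real.exp (a ^ 2 / 2) * Real.exp (-(‖x‖ ^ 2 / 2))
  rw [Real.norm_eq_abs, Real.abs_exp, ← Real.exp_add, Real.exp_le_exp]
  nlinarith [sq_nonneg (a - ‖x‖)]

/-- The Gaussian absorbs the exponential in `L²`, and a product of two `L²` functions is integrable.
-/
theorem integrable_exp_mul_norm_gaussian_mul {u : Config M → ℂ} (hu : MemLp u 2) (a : ℝ) :
    Integrable fun x => Real.exp (a * ‖x‖) * ‖(Real.exp (-(‖x‖ ^ 2 / 2)) : ℂ) * u x‖ := by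
  have h1 : MemLp (fun x : Config M => Real.exp (a * ‖x‖ - ‖x‖ ^ 2 / 2)) 2 := by
    rw [memLp_two_iff_integrable_sq (by fun_prop)]
    refine (integrable_exp_mul_gaussian (M := M) (2 * a)).congr
      (Filter.Eventually.of_forall fun x => ?_)
    simp only
    rw [← Real.exp_nat_mul]
    congr 1
    push_cast
    ring
  refine (h1.integrable_mul hu.norm).congr (Filter.Eventually.of_forall fun x => ?_)
  simp only [Pi.mul_apply]
  rw [norm_mul, Complex.norm_real, Real.norm_eq_abs, Real.abs_exp, ← mul_assoc, ← Real.exp_add,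
    ← sub_eq_add_neg]

theorem inner_toL2_eq_integral (f : 𝓢(Config M, Atoms M)) (g : HilbertSpace M) :
    ⟪toL2 M f, g⟫_ℂ = ∫ x, ⟪f x, g x⟫_ℂ := by
  rw [L2.inner_def]
  refine integral_congr_ae ?_
  filter_upwards [f.coeFn_toLp 2 (volume : Measure (Config M))] with x hx
  exact congrArg (fun v => ⟪v, g x⟫_ℂ) hx

/-- Pairing `g` with `⟪x, ξ⟫ ^ n` times the ground state `ket 0 b` gives, up to a nonzero constant,
the moments of the Gaussian times the component `g b`. -/
theorem eq_zero_of_forall_inner_finiteExcitation {g : HilbertSpace M}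
    (hg : ∀ f ∈ finiteExcitation M, ⟪toL2 M f, g⟫_ℂ = 0) : g = 0 := by
  have hcoord (b : Fin M → Fin 2) : MemLp (fun x => g x b) 2 (volume : Measure (Config M)) :=
    (Lp.memLp g).continuousLinearMap_comp (EuclideanSpace.proj (𝕜 := ℂ) b)
  have hb (b : Fin M → Fin 2) : ∀ᵐ x, g x b = 0 := by
    have h := ae_eq_zero_of_moments_eq_zero
      (G := fun x : Config M => (Real.exp (-(‖x‖ ^ 2 / 2)) : ℂ) * g x b)
      (AEStronglyMeasurable.mul (Continuous.aestronglyMeasurable (by fun_prop))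
        (hcoord b).aestronglyMeasurable)
      (integrable_exp_mul_norm_gaussian_mul (hcoord b)) (fun ξ n => by
        obtain ⟨f, hf, hfx⟩ := exists_mem_finiteExcitation_inner_pow b ξ n
        have h0 := hg f hf
        rw [inner_toL2_eq_integral] at h0
        have hpt : ∀ x, ⟪f x, g x⟫_ℂ = (((Real.sqrt (Real.sqrt Real.pi))⁻¹ ^ M : ℝ) : ℂ)
            * (((⟪x, ξ⟫_ℝ : ℝ) : ℂ) ^ n * ((Real.exp (-(‖x‖ ^ 2 / 2)) : ℂ) * g x b)) := fun x => by
          rw [hfx, ket_zero_apply, ← Complex.coe_smul, inner_smul_left, inner_smul_left,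
            EuclideanSpace.inner_single_left]
          simp only [map_pow, Complex.conj_ofReal, map_one]
          push_cast
          ring
        simp only [hpt] at h0
        rw [integral_const_mul] at h0
        refine (mul_eq_zero.1 h0).resolve_left ?_
        have : (0 : ℝ) < (Real.sqrt (Real.sqrt Real.pi))⁻¹ ^ M := by
          have := Real.pi_pos
          positivity
        exact_mod_cast this.ne')
    filter_upwards [h] with x hx
    refine (mul_eq_zero.1 hx).resolve_left ?_
    exact_mod_cast (Real.exp_pos _).ne'
  rw [Lp.eq_zero_iff_ae_eq_zero]
  filter_upwards [ae_all_iff.2 hb] with x hx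
  ext b
  exact hx b

/-- The Hilbert basis `|m₁⟩ ⊗ |b₁⟩ ⊗ ⋯ ⊗ |m_M⟩ ⊗ |b_M⟩`. -/
noncomputable def ketBasis (M : ℕ) : HilbertBasis ((Fin M → ℕ) × (Fin M → Fin 2)) ℂ (HilbertSpace M) :=
  HilbertBasis.mkOfOrthogonalEqBot orthonormal_ket (by
    rw [Submodule.eq_bot_iff]
    intro g hg
    refine eq_zero_of_forall_inner_finiteExcitation fun f hf => ?_
    refine (Submodule.mem_orthogonal _ _).1 hg _ ?_
    have h := Submodule.mem_map_of_mem (f := toL2 M) hf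
    rw [finiteExcitation, Submodule.map_span, ← Set.range_comp] at h
    exact h)

theorem ketBasis_apply (p : (Fin M → ℕ) × (Fin M → Fin 2)) :
    ketBasis M p = toL2 M (ket p.1 p.2) := by
  rw [ketBasis, HilbertBasis.coe_mkOfOrthogonalEqBot]

theorem onFiniteExcitation_domain (T : 𝓢(Config M, Atoms M) →L[ℂ] 𝓢(Config M, Atoms M)) :
    (onFiniteExcitation T).domain = Submodule.span ℂ (Set.range (ketBasis M)) := by
  have : (⇑(ketBasis M)) = toL2 M ∘ fun p => ket p.1 p.2 := funext ketBasis_apply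
  rw [this, Set.range_comp, ← Submodule.map_span]
  rfl

end Completeness

end JCH

/-! ### The Hamiltonian as a diagonal operator plus weighted involutions -/

namespace JCH

open Filter

section Model

variable {M : ℕ}

/-- The excitation exchange between the oscillator and the atom at site `k`: it interchanges
`|m⟩ ⊗ |1⟩` and `|m + 1⟩ ⊗ |0⟩`, and fixes `|0⟩ ⊗ |0⟩`. -/
def exchange (k : Fin M) (p : (Fin M → ℕ) × (Fin M → Fin 2)) :
    (Fin M → ℕ) × (Fin M → Fin 2) :=
  if p.2 k = 1 then (Function.update p.1 k (p.1 k + 1), Function.update p.2 k 0)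
  else if p.1 k = 0 then p
  else (Function.update p.1 k (p.1 k - 1), Function.update p.2 k 1)

theorem exchange_involutive (k : Fin M) : Function.Involutive (exchange k) := by
  rintro ⟨m, b⟩
  by_cases hb : b k = 1
  · simp [exchange, hb]
  · have hb0 : b k = 0 := by omega
    by_cases hm : m k = 0
    · simp [exchange, hb, hm]
    · have : m k - 1 + 1 = m k := Nat.sub_add_cancel (Nat.pos_of_ne_zero hm)
      simp [exchange, hb0, hm, this]

/-- The number of excitations at site `k`. -/
def excitationNumber (k : Fin M) (p : (Fin M → ℕ) × (Fin M → Fin 2)) : ℕ := p.1 k + (p.2 k : ℕ)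

/-- Conservation of the excitation number makes the coupling weights invariant under `exchange`,
hence the coupling symmetric. -/
theorem excitationNumber_exchange (k : Fin M) (p : (Fin M → ℕ) × (Fin M → Fin 2)) :
    excitationNumber k (exchange k p) = excitationNumber k p := by
  by_cases hb : p.2 k = 1
  · simp [exchange, excitationNumber, hb]
  · have hb0 : p.2 k = 0 := by omega
    by_cases hm : p.1 k = 0
    · simp [exchange, excitationNumber, hb, hm]
    · have : p.1 k - 1 + 1 = p.1 k := Nat.sub_add_cancel (Nat.pos_of_ne_zero hm)
      simp [exchange, excitationNumber, hb0, hm, this]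

/-- The flip of the atom at site `k`. -/
def atomFlip (k : Fin M) (p : (Fin M → ℕ) × (Fin M → Fin 2)) :
    (Fin M → ℕ) × (Fin M → Fin 2) :=
  (p.1, Function.update p.2 k (1 - p.2 k))

theorem atomFlip_involutive (k : Fin M) : Function.Involutive (atomFlip k) := by
  rintro ⟨m, b⟩
  simp [atomFlip]

theorem atomOp_σz_ket (k : Fin M) (p : (Fin M → ℕ) × (Fin M → Fin 2)) :
    atomOp k σz (ket p.1 p.2) = ((if p.2 k = 1 then 1 else -1 : ℝ) : ℂ) • ket p.1 p.2 := by
  rw [atomOp_ket, Fin.sum_univ_two]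
  rcases (by omega : p.2 k = 0 ∨ p.2 k = 1) with h | h
  · have : Function.update p.2 k 0 = p.2 := by rw [← h, Function.update_eq_self]
    simp [σz, h, this]
  · have : Function.update p.2 k 1 = p.2 := by rw [← h, Function.update_eq_self]
    simp [σz, h, this]

theorem atomOp_σx_ket (k : Fin M) (p : (Fin M → ℕ) × (Fin M → Fin 2)) :
    atomOp k σx (ket p.1 p.2) = ket (atomFlip k p).1 (atomFlip k p).2 := by
  rw [atomOp_ket, Fin.sum_univ_two, atomFlip]
  rcases (by omega : p.2 k = 0 ∨ p.2 k = 1) with h | h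
  · simp [σx, h]
  · simp [σx, h]

/-- On an excited atom only `a* σ⁻` acts, with factor `√(m + 1)`; on a ground-state atom only `a
σ⁺`, with factor `√m`. Both are the root of the excitation number, which vanishes at the fixed
points of `exchange`. -/
theorem exchange_ket (k : Fin M) (p : (Fin M → ℕ) × (Fin M → Fin 2)) :
    creation k (atomOp k σminus (ket p.1 p.2)) + annihilation k (atomOp k σplus (ket p.1 p.2))
      = ((Real.sqrt (excitationNumber k p) : ℝ) : ℂ)
        • ket (exchange k p).1 (exchange k p).2 := by
  rw [atomOp_ket, atomOp_ket, Fin.sum_univ_two, Fin.sum_univ_two, σminus_eq, σplus_eq]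
  rcases (by omega : p.2 k = 0 ∨ p.2 k = 1) with h | h
  · by_cases hm : p.1 k = 0
    · simp [exchange, excitationNumber, h, hm, annihilation_ket]
    · simp [exchange, excitationNumber, h, hm, annihilation_ket]
  · simp [exchange, excitationNumber, h, creation_ket]

theorem drift_ket (ωP ωA ωI : Fin M → ℝ) (p : (Fin M → ℕ) × (Fin M → Fin 2)) :
    drift ωP ωA ωI (ket p.1 p.2)
      = ((∑ k, ωP k * p.1 k : ℝ) : ℂ) • ket p.1 p.2
        + (∑ k, ((ωA k * (if p.2 k = 1 then 1 else -1) : ℝ) : ℂ) • ket p.1 p.2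
        + ∑ k, ((ωI k * Real.sqrt (excitationNumber k p) : ℝ) : ℂ)
          • ket (exchange k p).1 (exchange k p).2) := by
  have hP : freePhoton ωP (ket p.1 p.2) = ((∑ k, ωP k * p.1 k : ℝ) : ℂ) • ket p.1 p.2 := by
    rw [freePhoton, sum_apply, Complex.ofReal_sum, Finset.sum_smul]
    refine Finset.sum_congr rfl fun k _ => ?_
    rw [smul_apply, ContinuousLinearMap.comp_apply, creation_annihilation_ket, smul_smul]
    push_cast
    rfl
  have hA : freeAtom ωA (ket p.1 p.2)
      = ∑ k, ((ωA k * (if p.2 k = 1 then 1 else -1) : ℝ) : ℂ) • ket p.1 p.2 := by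
    rw [freeAtom, sum_apply]
    refine Finset.sum_congr rfl fun k _ => ?_
    rw [smul_apply, atomOp_σz_ket, smul_smul, Complex.ofReal_mul]
  have hI : interaction ωI (ket p.1 p.2)
      = ∑ k, ((ωI k * Real.sqrt (excitationNumber k p) : ℝ) : ℂ)
          • ket (exchange k p).1 (exchange k p).2 := by
    rw [interaction, sum_apply]
    refine Finset.sum_congr rfl fun k _ => ?_
    rw [smul_apply, add_apply, ContinuousLinearMap.comp_apply, ContinuousLinearMap.comp_apply,
      exchange_ket, smul_smul, Complex.ofReal_mul]
  rw [drift, add_apply, add_apply, hP, hA, hI]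
  abel

/-- A bound `C` on the energy forces `m k ≤ C / ωP k` for every `k`, and there are finitely many
atomic states. -/
theorem tendsto_photonEnergy {ωP : Fin M → ℝ} (hP : ∀ k, 0 < ωP k) :
    Tendsto (fun p : (Fin M → ℕ) × (Fin M → Fin 2) => ∑ k, ωP k * p.1 k) cofinite atTop := by
  rw [tendsto_atTop]
  intro C
  rw [eventually_cofinite]
  have hfin : {m : Fin M → ℕ | ∀ k, m k ∈ Set.Iic ⌈C / ωP k⌉₊}.Finite :=
    Set.Finite.pi' fun k => Set.finite_Iic _
  refine (hfin.prod (Set.finite_univ (α := Fin M → Fin 2))).subset ?_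
  rintro ⟨m, b⟩ hp
  refine ⟨fun k => ?_, Set.mem_univ _⟩
  have hle : ωP k * m k ≤ ∑ k, ωP k * m k :=
    Finset.single_le_sum (f := fun k => ωP k * (m k : ℝ))
      (fun k _ => mul_nonneg (hP k).le (Nat.cast_nonneg _)) (Finset.mem_univ k)
  have hlt : ∑ k, ωP k * (m k : ℝ) < C := not_le.1 hp
  have : (m k : ℝ) ≤ C / ωP k := by
    rw [le_div_iff₀ (hP k)]
    linarith
  exact_mod_cast this.trans (Nat.le_ceil _)

/-- The coupling `w √n` is infinitesimally small relative to `n`. -/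
theorem mul_sqrt_le {a w ε : ℝ} (ha : 0 < a) (hε : 0 < ε) {y : ℝ} (hy : 0 ≤ y) :
    |w * Real.sqrt y| ≤ ε * (a * y + w ^ 2 / (ε ^ 2 * a)) := by
  have hsq := Real.sq_sqrt hy
  have h0 : 0 < ε * a := mul_pos hε ha
  -- Over the common denominator `ε * a` the claim becomes an arithmetic–geometric mean inequality
  -- for `ε a √y` and `|w|`.
  have h1 : ε * (a * y + w ^ 2 / (ε ^ 2 * a))
      = ((ε * a) ^ 2 * Real.sqrt y ^ 2 + |w| ^ 2) / (ε * a) := by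
    rw [hsq, sq_abs]
    field_simp
  rw [h1, le_div_iff₀ h0, abs_mul, abs_of_nonneg (Real.sqrt_nonneg y)]
  nlinarith [sq_nonneg (ε * a * Real.sqrt y - |w|), sq_nonneg (ε * a * Real.sqrt y + |w|)]

end Model

end JCH

theorem mainTheorem10 (M : ℕ) (ωP ωA ωI : Fin M → ℝ)
    (hP : ∀ k, 0 < ωP k) (hA : ∀ k, 0 < ωA k) (hI : ∀ k, 0 < ωI k) (i : Fin M) :
    IsSelfAdjoint
        (JCH.onFiniteExcitation (JCH.drift ωP ωA ωI + JCH.atomOp i JCH.σx)).closure ∧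
      JCH.HasCompactResolvent
        (JCH.onFiniteExcitation (JCH.drift ωP ωA ωI + JCH.atomOp i JCH.σx)).closure := by
  have hlam0 (p : (Fin M → ℕ) × (Fin M → Fin 2)) : 0 ≤ ∑ k, ωP k * (p.1 k : ℝ) :=
    Finset.sum_nonneg fun k _ => mul_nonneg (hP k).le (Nat.cast_nonneg _)
  have hconst {C d ε l : ℝ} (hε : 0 < ε) (hl : 0 ≤ l) (hd : |d| ≤ C) (s : ℝ) (hs : s ≥ C / ε) :
      |d| ≤ ε * (l + s) := by
    have : C ≤ s * ε := (div_le_iff₀ hε).1 hs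
    nlinarith [mul_nonneg hε.le hl]
  -- The atomic energy is treated as a perturbation along the identity permutation, which keeps the
  -- diagonal part `lam` nonnegative. The single remaining index carries `σx` at site `i`.
  refine JCH.isSelfAdjoint_closure_and_hasCompactResolvent (L := Fin M ⊕ Fin M ⊕ Unit)
    (JCH.ketBasis M) (JCH.onFiniteExcitation_domain _)
    (lam := fun p => ∑ k, ωP k * (p.1 k : ℝ))
    (π := Sum.elim (fun _ => 1) (Sum.elim (fun k => (JCH.exchange_involutive k).toPerm)
      fun _ => (JCH.atomFlip_involutive i).toPerm))
    (c := Sum.elim (fun k p => ωA k * (if p.2 k = 1 then 1 else -1))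
      (Sum.elim (fun k p => ωI k * Real.sqrt (JCH.excitationNumber k p)) fun _ _ => 1))
    ?_ hlam0 (JCH.tendsto_photonEnergy hP) ?_ ?_ ?_
  · intro p h
    have hp : (⟨JCH.ketBasis M p, h⟩ :
        (JCH.onFiniteExcitation (JCH.drift ωP ωA ωI + JCH.atomOp i JCH.σx)).domain)
        = ⟨JCH.toL2 M (JCH.ket p.1 p.2),
          Submodule.mem_map_of_mem (JCH.ket_mem_finiteExcitation p.1 p.2)⟩ :=
      Subtype.ext (JCH.ketBasis_apply p)
    rw [hp, JCH.onFiniteExcitation_apply _ ⟨_, JCH.ket_mem_finiteExcitation p.1 p.2⟩]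
    simp only [add_apply, JCH.drift_ket, JCH.atomOp_σx_ket, map_add, map_sum, map_smul,
      Fintype.sum_sum_type, Sum.elim_inl, Sum.elim_inr, JCH.ketBasis_apply,
      Equiv.Perm.one_apply, Function.Involutive.coe_toPerm, Finset.univ_unique,
      Finset.sum_singleton, Complex.ofReal_one, one_smul]
    abel
  · rintro (k | k | _)
    · exact fun _ => rfl
    · exact JCH.exchange_involutive k
    · exact JCH.atomFlip_involutive i
  · rintro (k | k | _) p
    · rfl
    · simp [JCH.excitationNumber_exchange]
    · rfl
  · rintro (k | k | _) ε hε
    · refine ⟨|ωA k| / ε, fun s hs p => hconst hε (hlam0 p) ?_ s hs⟩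
      simp only [Sum.elim_inl]
      split_ifs <;> simp
    -- The second summand is the constant of `mul_sqrt_le` with `a = ωP k`; the first absorbs the
    -- excess of the excitation number over the photon number, at most one.
    · refine ⟨ωP k + ωI k ^ 2 / (ε ^ 2 * ωP k), fun s hs p => ?_⟩
      simp only [Sum.elim_inl, Sum.elim_inr]
      refine (JCH.mul_sqrt_le (hP k) hε (Nat.cast_nonneg _)).trans
        (mul_le_mul_of_nonneg_left ?_ hε.le)
      have hle : ωP k * p.1 k ≤ ∑ k, ωP k * (p.1 k : ℝ) :=
        Finset.single_le_sum (f := fun k => ωP k * (p.1 k : ℝ))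
          (fun k _ => mul_nonneg (hP k).le (Nat.cast_nonneg _)) (Finset.mem_univ k)
      have hn : (JCH.excitationNumber k p : ℝ) ≤ p.1 k + 1 := by
        have : JCH.excitationNumber k p ≤ p.1 k + 1 := by
          rw [JCH.excitationNumber]
          omega
        exact_mod_cast this
      nlinarith [mul_le_mul_of_nonneg_left hn (hP k).le]
    · refine ⟨1 / ε, fun s hs p => hconst hε (hlam0 p) ?_ s hs⟩
      simp
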